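/- **Setting.** Let $G$ be a finite group of exponent $n$, and let $R$ be a complete discrete valuation ring whose residue field $k$ has characteristic prime to $n$ (i.e. $n\neq 0$ in $k$) and which contains a primitive $n$-th root of unity. Let $Y\to S=\mathrm{Spec}(R)$ be a flat proper (for instance projective) morphism with $Y$ a regular scheme, and let $\pi:X\to Y$ be a $G$-cover (a finite morphism, with $G$ acting on $X$ over $Y$, such that $\mathcal O_Y=(\pi_*\mathcal O_X)^G$) which is a $G$-torsor over a dense open subscheme of $Y$, with $X$ regular. For a point $x$ of codimension one of $X$ let $I_x$ be its inertia group (the $g\in G$ fixing $x$ and acting trivially on its residue field $\kappa(x)$), let $e_x=|I_x|$, and let $\psi_x:I_x\to\kappa(x)^\times$ be the character given by the action of $I_x$ on the cotangent space $\mathfrak m_x/\mathfrak m_x^2$. For a character $\varphi:G\to R^\times$ let $\bar\varphi=\varphi^{-1}$ be its conjugate, and let $n(\varphi,x)$ be the integer with $0\le n(\varphi,x)<e_x$ such that $\varphi|_{I_x}=\psi_x^{n(\varphi,x)}$ (in $\kappa(x)^\times$); it depends only on $y=\pi(x)$ and is also denoted $n(\varphi,y)$. Put $$f(\varphi)=\sum_{n(\varphi,y)>0}y,$$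 where $y$ runs over the points of codimension one of $Y$ that are contained in the special fibre of $Y\to S$ and satisfy $n(\varphi,y)>0$. Let $\mathcal K_X$, $\mathcal K_Y$ be the sheaves of meromorphic functions. For $\mathcal F=\mathcal O_X(D)\subset\mathcal K_X$, with $D$ a $G$-invariant divisor on $X$, let $\mathcal F_\varphi$ be the subsheaf of $\pi_*\mathcal F$ of the sections on which $G$ acts (by pullback of functions) by the character $\varphi$. Multiplication maps $\mathcal F_\varphi^{\otimes n}$ onto a subsheaf $\mathcal F_\varphi^{n}$ of $\mathcal K_Y$. For a point $y$ of codimension one of $Y$ in the special fibre, the stalk of $\mathcal F_\varphi^{n}$ at $y$ is $\mathfrak m_y^{m}$ for an integer $m$; put $v_y(\mathcal F_\varphi)=m/n\in\mathbf Q$. The resolvent divisor of $\mathcal F$ at $\varphi$ is $$r(\mathcal F,\varphi)=\sum_y v_y(\mathcal F_\varphi)\,y ,$$ where $y$ runs over the points of codimension one of $Y$ contained in the special fibre. If all $e_x$ are odd, let $\omega_{X/Y}^{1/2}=\mathcal O_X\big(\sum_x\frac{e_x-1}{2}\,x\big)$, where $x$ runs over the points of codimension one of $X$. **Corollary 3.8.**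 For every character $\varphi:G\to R^\times$: (i) $r(\mathcal O_X,\varphi)+r(\mathcal O_X,\bar\varphi)=f(\varphi)$. If moreover $e_x$ is odd for every point $x$ of codimension one of $X$, then (ii) $r(\omega_{X/Y}^{1/2},\varphi)+r(\omega_{X/Y}^{1/2},\bar\varphi)=0$; (iii) $r(\omega_{X/Y}^{1/2},\varphi)=r(\mathcal O_X,\varphi^2)-r(\mathcal O_X,\varphi)$. -/

import Mathlib

open CategoryTheory CategoryTheory.Limits AlgebraicGeometry IsLocalRing TopologicalSpace

universe u v

noncomputable section

namespace ResolventDivisor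

/-- A scheme is regular: it is locally Noetherian and all its local rings are regular. -/
def IsRegularScheme (Z : Scheme.{u}) : Prop :=
  IsLocallyNoetherian Z ∧ ∀ z : Z, IsRegularLocalRing (Z.presheaf.stalk z)

/-- The points of codimension one of a scheme: the local ring has Krull dimension one. -/
abbrev CodimOne (Z : Scheme.{u}) : Type u :=
  {z : Z // ringKrullDim (Z.presheaf.stalk z) = 1}

/-- For a scheme `Z` over `Spec R`, the structural ring homomorphism `R → 𝒪_{Z,z}`. -/
def scalar {R : Type u} [CommRing R] {Z : Scheme.{u}} (p : Z ⟶ Spec (CommRingCat.of R)) (z : Z) :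
    R →+* Z.presheaf.stalk z :=
  ((Scheme.ΓSpecIso (CommRingCat.of R)).inv ≫ p.appTop ≫
    Z.presheaf.germ ⊤ z trivial).hom

section Action

variable {G : Type v} [Group G] {X Y : Scheme.{u}} {π : X ⟶ Y}

/-- The automorphism of `X` given by `g`, for a (left) action `ρ` of `G` on the
`Y`-scheme `π : X ⟶ Y`. -/
def act (ρ : G →* Aut (Over.mk π)) (g : G) : X ⟶ X := (ρ g).hom.left

lemma act_comp (ρ : G →* Aut (Over.mk π)) (g : G) : act ρ g ≫ π = π :=
  Over.w (ρ g).hom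

lemma act_one (ρ : G →* Aut (Over.mk π)) : act ρ 1 = 𝟙 X := by
  simp only [act, map_one]; rfl

lemma act_mul (ρ : G →* Aut (Over.mk π)) (g h : G) :
    act ρ (g * h) = act ρ h ≫ act ρ g := by
  simp only [act, map_mul]; rfl

lemma act_inv_comp (ρ : G →* Aut (Over.mk π)) (g : G) : act ρ g⁻¹ ≫ act ρ g = 𝟙 X := by
  rw [← act_mul, mul_inv_cancel, act_one]

lemma comp_act_inv (ρ : G →* Aut (Over.mk π)) (g : G) : act ρ g ≫ act ρ g⁻¹ = 𝟙 X := by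
  rw [← act_mul, inv_mul_cancel, act_one]

lemma π_act (ρ : G →* Aut (Over.mk π)) (g : G) (x : X) : π (act ρ g x) = π x := by
  rw [← Scheme.Hom.comp_apply, act_comp]

/-- `π : X ⟶ Y` is a `G`-cover: it is finite and identifies `Y` with the quotient `X / G`, that is
`𝒪_Y` is the sheaf of `G`-invariants of `π_* 𝒪_X`. -/
structure IsGCover (ρ : G →* Aut (Over.mk π)) : Prop where
  finite : IsFinite π
  invariants : ∀ (V : Y.Opens) (s : Γ(X, π ⁻¹ᵁ V)),
    (∀ g : G, (act ρ g).appLE (π ⁻¹ᵁ V) (π ⁻¹ᵁ V)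
      (by rw [← Scheme.Hom.comp_preimage, act_comp]) s = s) →
    ∃! t : Γ(Y, V), π.app V t = s

/-- The morphism `G × X ⟶ X ×_Y X`, `(g, x) ↦ (x, g x)`, where `G × X` is the disjoint union
of copies of `X` indexed by `G`. -/
def actionMap [Finite G] (ρ : G →* Aut (Over.mk π)) : (∐ fun _ : G => X) ⟶ pullback π π :=
  Sigma.desc fun g => pullback.lift (𝟙 X) (act ρ g) (by rw [act_comp, Category.id_comp])

/-- `X` is generically a `G`-torsor on `Y`: over some dense open subscheme `V` of `Y` the morphism
`π` is an étale covering and `G × X ⟶ X ×_Y X` is an isomorphism. -/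
def IsGenericallyTorsor [Finite G] (ρ : G →* Aut (Over.mk π)) : Prop :=
  ∃ V : Y.Opens, Dense (V : Set Y) ∧ Etale (π ∣_ V) ∧ Surjective (π ∣_ V) ∧
    IsIso (actionMap ρ ∣_ ((pullback.fst π π ≫ π) ⁻¹ᵁ V))

/-- The inertia group `I_x` of a point `x` of `X`: the elements of `G` that fix `x` and act
trivially on the residue field `κ(x)`. -/
def inertia (ρ : G →* Aut (Over.mk π)) (x : X) : Subgroup G where
  carrier := {g | X.fromSpecResidueField x ≫ act ρ g = X.fromSpecResidueField x}
  one_mem' := by simp [act_one]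
  mul_mem' {g h} hg hh := by
    simp only [Set.mem_ofPred_eq] at *
    rw [act_mul, ← Category.assoc, hh, hg]
  inv_mem' {g} hg := by
    simp only [Set.mem_ofPred_eq] at *
    conv_lhs => rw [← hg]
    rw [Category.assoc, comp_act_inv, Category.comp_id]

/-- The ramification index `e_x`: the order of the inertia group `I_x`. -/
def ramIndex (ρ : G →* Aut (Over.mk π)) (x : X) : ℕ := Nat.card (inertia ρ x)

lemma inertia_fix (ρ : G →* Aut (Over.mk π)) {x : X} {g : G} (hg : g ∈ inertia ρ x) :
    act ρ g x = x := by
  have h : X.fromSpecResidueField x ≫ act ρ g = X.fromSpecResidueField x := hg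
  have h2 := congrArg (fun q => q (closedPoint (X.residueField x))) h
  have h3 : act ρ g (X.fromSpecResidueField x (closedPoint (X.residueField x))) =
      X.fromSpecResidueField x (closedPoint (X.residueField x)) := h2
  have e : X.fromSpecResidueField x (closedPoint (X.residueField x)) = x :=
    Scheme.fromSpecResidueField_apply x _
  rwa [e] at h3

/-- The action `t ↦ t ^ g` (pullback of functions along `g`) of an element `g` of the inertia group
`I_x` on the local ring `𝒪_{X,x}`. -/
def inertiaAct (ρ : G →* Aut (Over.mk π)) (x : X) (g : inertia ρ x) :
    X.presheaf.stalk x →+* X.presheaf.stalk x :=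
  (X.presheaf.stalkSpecializes (specializes_of_eq (inertia_fix ρ g.2)) ≫
    (act ρ g.1).stalkMap x).hom

/-- `ψ` describes the action of `I_x` on the cotangent space `𝔪_x / 𝔪_x ^ 2`: each `g` in `I_x` acts
on it as multiplication by the scalar `ψ g` of `κ(x)`. -/
def IsCotangentCharacter (ρ : G →* Aut (Over.mk π)) (x : X)
    (ψ : inertia ρ x →* (X.residueField x)ˣ) : Prop :=
  ∀ (g : inertia ρ x) (a t : X.presheaf.stalk x), X.residue x a = (ψ g : X.residueField x) →
    t ∈ maximalIdeal (X.presheaf.stalk x) →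
    inertiaAct ρ x g t - a * t ∈ maximalIdeal (X.presheaf.stalk x) ^ 2

open scoped Classical in
/-- The character `ψ_x` of `I_x` with values in `κ(x)ˣ` defined by the action of `I_x` on the
cotangent space at `x`. (It exists and is unique when the cotangent space is a line, as it is at a
point of codimension one of a regular scheme.) -/
def cotangentCharacter (ρ : G →* Aut (Over.mk π)) (x : X) :
    inertia ρ x →* (X.residueField x)ˣ :=
  if h : ∃ ψ, IsCotangentCharacter ρ x ψ then h.choose else 1

variable {R : Type u} [CommRing R]

/-- The integer `n(φ, x)` with `0 ≤ n(φ, x) < e_x` such that the restriction of `φ` to `I_x` equals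
`ψ_x ^ n(φ, x)`. The values of `φ` lie in `Rˣ`, those of `ψ_x` in `κ(x)ˣ`; they are compared in
`κ(x)ˣ`; when `n` is invertible in the residue field of `R`, reduction is injective on the `n`-th roots
of unity of `R`, so this is the same as a comparison in `Rˣ`. -/
def cotangentExponent (ρ : G →* Aut (Over.mk π)) (f : Y ⟶ Spec (CommRingCat.of R)) (φ : G →* Rˣ)
    (x : X) : ℕ :=
  sInf {k | k < ramIndex ρ x ∧ ∀ g : inertia ρ x,
    X.residue x (scalar (π ≫ f) x (φ g.1 : R)) = (cotangentCharacter ρ x g : X.residueField x) ^ k}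

/-! ### Meromorphic functions, the sheaves `𝒪_X(D)`, and resolvent sheaves -/

/-- The generic points `η` of (irreducible components of) `X`, that is the points without proper
generization, such that `π η` specializes to the point `y` of `Y`. -/
abbrev GenericOver (π : X ⟶ Y) (y : Y) : Type u :=
  {η : X // (∀ z : X, z ⤳ η → z = η) ∧ π η ⤳ y}

/-- The stalk at `y` of `π_* 𝒦_X`, where `𝒦_X` is the sheaf of meromorphic functions of the (regular,
so reduced and locally integral) scheme `X`: the product of the local rings of `X` at the generic
points `η` of `X` such that `y` is a specialization of `π η`. -/
def MeroStalk (π : X ⟶ Y) (y : Y) : Type u :=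
  (η : GenericOver π y) → X.presheaf.stalk η.1

instance (π : X ⟶ Y) (y : Y) : CommRing (MeroStalk π y) :=
  inferInstanceAs (CommRing ((η : GenericOver π y) → X.presheaf.stalk η.1))

/-- The homomorphism `𝒪_{Y,y} → 𝒪_{X,x}` when `y` is a specialization of `π x`. -/
def pullStalk (π : X ⟶ Y) {x : X} {y : Y} (h : π x ⤳ y) :
    Y.presheaf.stalk y →+* X.presheaf.stalk x :=
  (Y.presheaf.stalkSpecializes h ≫ π.stalkMap x).hom

/-- The stalk `(π_* 𝒦_X)_y` is an `𝒪_{Y,y}`-algebra. -/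
instance (π : X ⟶ Y) (y : Y) : Algebra (Y.presheaf.stalk y) (MeroStalk π y) :=
  RingHom.toAlgebra (RingHom.pi fun η : GenericOver π y => pullStalk π η.2.2)

lemma algebraMap_apply (π : X ⟶ Y) (y : Y) (a : Y.presheaf.stalk y) (η : GenericOver π y) :
    algebraMap (Y.presheaf.stalk y) (MeroStalk π y) a η = pullStalk π η.2.2 a := rfl

lemma smul_apply (π : X ⟶ Y) (y : Y) (a : Y.presheaf.stalk y) (s : MeroStalk π y)
    (η : GenericOver π y) : (a • s) η = pullStalk π η.2.2 a * s η := by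
  rw [Algebra.smul_def]; rfl

lemma specializes_act (ρ : G →* Aut (Over.mk π)) (g : G) {η z : X} (h : z ⤳ act ρ g η) :
    act ρ g⁻¹ z ⤳ η := by
  have h1 := h.map (act ρ g⁻¹).continuous
  rw [← Scheme.Hom.comp_apply, comp_act_inv] at h1
  exact h1

lemma generic_act (ρ : G →* Aut (Over.mk π)) (g : G) {η : X} (hη : ∀ z : X, z ⤳ η → z = η)
    (z : X) (h : z ⤳ act ρ g η) : z = act ρ g η := by
  rw [← hη _ (specializes_act ρ g h), ← Scheme.Hom.comp_apply, act_inv_comp]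
  rfl

lemma pullStalk_comp {Z : Scheme.{u}} (p : X ⟶ Z) (q : Z ⟶ Y) (r : X ⟶ Y) (hpq : p ≫ q = r)
    {x : X} {y : Y} (h : q (p x) ⤳ y) (h' : r x ⤳ y) (a : Y.presheaf.stalk y) :
    p.stalkMap x (pullStalk q h a) = pullStalk r h' a := by
  subst hpq
  simp only [pullStalk, Scheme.Hom.stalkMap_comp]
  rfl

lemma stalkSpecializes_pullStalk (π : X ⟶ Y) {η x : X} {y : Y} (h : η ⤳ x) (hη : π η ⤳ y)
    (hx : π x ⤳ y) (a : Y.presheaf.stalk y) :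
    X.presheaf.stalkSpecializes h (pullStalk π hx a) = pullStalk π hη a := by
  simp only [pullStalk, CommRingCat.hom_comp, RingHom.comp_apply]
  rw [← Scheme.Hom.stalkSpecializes_stalkMap_apply]
  congr 1
  exact congrArg (fun q => q.hom a)
    (TopCat.Presheaf.stalkSpecializes_comp Y.presheaf (h.map π.continuous) hx)

/-- The action `s ↦ s ^ g` (pullback of functions along `g`) of `G` on the stalk `(π_* 𝒦_X)_y`. -/
def pullMero (ρ : G →* Aut (Over.mk π)) (y : Y) (g : G) : MeroStalk π y →+* MeroStalk π y :=
  RingHom.pi fun η : GenericOver π y =>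
    ((act ρ g).stalkMap η.1).hom.comp
      (Pi.evalRingHom (fun η : GenericOver π y => X.presheaf.stalk η.1)
        ⟨act ρ g η.1, generic_act ρ g η.2.1, by rw [π_act]; exact η.2.2⟩)

lemma pullMero_algebraMap (ρ : G →* Aut (Over.mk π)) (y : Y) (g : G) (a : Y.presheaf.stalk y) :
    pullMero ρ y g (algebraMap _ (MeroStalk π y) a) = algebraMap _ (MeroStalk π y) a := by
  funext η
  exact pullStalk_comp (act ρ g) π π (act_comp ρ g) _ _ a

/-- The `φ`-isotypic part of `(π_* 𝒦_X)_y`: the elements on which `G` acts by the character `φ`. -/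
def eigenStalk (ρ : G →* Aut (Over.mk π)) (f : Y ⟶ Spec (CommRingCat.of R)) (φ : G →* Rˣ) (y : Y) :
    Submodule (Y.presheaf.stalk y) (MeroStalk π y) where
  carrier := {s | ∀ g : G, pullMero ρ y g s = scalar f y (φ g : R) • s}
  add_mem' {s t} hs ht g := by rw [map_add, hs g, ht g, smul_add]
  zero_mem' g := by rw [map_zero, smul_zero]
  smul_mem' a s hs g := by
    rw [Algebra.smul_def a s, map_mul, pullMero_algebraMap, hs g, ← Algebra.smul_def,
      ← Algebra.smul_def, smul_comm]

/-- A (Weil) divisor `∑ d_x x` on the scheme `X`, given by its coefficients. -/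
abbrev Divisor (X : Scheme.{u}) : Type u := CodimOne X → ℤ

/-- The stalk at `y` of `π_* 𝒪_X(D)`, where `𝒪_X(D)` is the invertible subsheaf of `𝒦_X` defined by the
divisor `D = ∑ d_x x`: the elements of `(π_* 𝒦_X)_y` which lie in `𝔪_x ^ (-d_x)` for every point `x`
of codimension one above `y`. That `s` lies in `𝔪_x ^ (-d)` is expressed by
`𝔪_x ^ d * s ⊆ 𝒪_{X,x}` if `0 ≤ d`, and by `s ∈ 𝔪_x ^ (-d)` if `d ≤ 0`. -/
def pushforwardStalk (π : X ⟶ Y) (D : Divisor X) (y : Y) :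
    Submodule (Y.presheaf.stalk y) (MeroStalk π y) where
  carrier := {s | ∀ x : CodimOne X, π x.1 = y →
    ∀ a ∈ maximalIdeal (X.presheaf.stalk x.1) ^ (D x).toNat,
    ∃ b ∈ maximalIdeal (X.presheaf.stalk x.1) ^ (-D x).toNat,
    ∀ (η : GenericOver π y) (h : η.1 ⤳ x.1),
      X.presheaf.stalkSpecializes h a * s η = X.presheaf.stalkSpecializes h b}
  add_mem' {s t} hs ht x hx a ha := by
    obtain ⟨b, hb, hb'⟩ := hs x hx a ha
    obtain ⟨c, hc, hc'⟩ := ht x hx a ha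
    refine ⟨b + c, add_mem hb hc, fun η h => ?_⟩
    rw [map_add, ← hb' η h, ← hc' η h, ← mul_add]
    rfl
  zero_mem' x hx a ha := by
    refine ⟨0, zero_mem _, fun η h => ?_⟩
    rw [map_zero]
    exact mul_zero _
  smul_mem' c s hs x hx a ha := by
    obtain ⟨b, hb, hb'⟩ := hs x hx a ha
    refine ⟨pullStalk π (specializes_of_eq hx) c * b, Ideal.mul_mem_left _ _ hb, fun η h => ?_⟩
    rw [map_mul, ← hb' η h, stalkSpecializes_pullStalk π h η.2.2, smul_apply, mul_left_comm]

/-- The stalk at `y` of the resolvent sheaf `ℱ_φ` of `ℱ = 𝒪_X(D)`: the subsheaf of `π_* ℱ` of the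
sections on which `G` acts by the character `φ`. -/
def resolventStalk (ρ : G →* Aut (Over.mk π)) (f : Y ⟶ Spec (CommRingCat.of R)) (D : Divisor X)
    (φ : G →* Rˣ) (y : Y) : Submodule (Y.presheaf.stalk y) (MeroStalk π y) :=
  pushforwardStalk π D y ⊓ eigenStalk ρ f φ y

/-- `N = 𝔪_y ^ m` for the `𝒪_{Y,y}`-submodule `N` of `(π_* 𝒦_X)_y` and the integer `m`, where
`𝔪_y ^ m` is the fractional ideal of `𝒪_{Y,y}`, embedded into `(π_* 𝒦_X)_y` along `𝒦_Y → π_* 𝒦_X`. For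
`m ≤ 0` the condition reads `𝔪_y ^ (-m) * N = 𝒪_{Y,y}`. -/
def HasValuation (π : X ⟶ Y) (y : Y) (N : Submodule (Y.presheaf.stalk y) (MeroStalk π y))
    (m : ℤ) : Prop :=
  maximalIdeal (Y.presheaf.stalk y) ^ (-m).toNat • N =
    maximalIdeal (Y.presheaf.stalk y) ^ m.toNat • (1 : Submodule (Y.presheaf.stalk y) (MeroStalk π y))

open scoped Classical in
/-- The valuation `v_y(N)`: the integer `m` with `N = 𝔪_y ^ m` (and `0` if there is none). -/
def valuation (π : X ⟶ Y) (y : Y) (N : Submodule (Y.presheaf.stalk y) (MeroStalk π y)) : ℤ :=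
  if h : ∃ m : ℤ, HasValuation π y N m then h.choose else 0

/-- The rational number `v_y(ℱ_φ) = (1 / n) v_y(ℱ_φ ^ n)` for `ℱ = 𝒪_X(D)` and `n` the exponent of `G`,
where `ℱ_φ ^ n` is the image of `ℱ_φ ^ {⊗ n}` under the multiplication `(π_* 𝒦_X) ^ {⊗ n} → π_* 𝒦_X`;
it is contained in `𝒦_Y`. -/
def resolventValuation (ρ : G →* Aut (Over.mk π)) (f : Y ⟶ Spec (CommRingCat.of R)) (D : Divisor X)
    (φ : G →* Rˣ) (y : Y) : ℚ :=
  (valuation π y (resolventStalk ρ f D φ y ^ Monoid.exponent G) : ℚ) / (Monoid.exponent G : ℚ)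

/-- The points of codimension one of `Y` contained in the special fibre of `Y ⟶ Spec R`, for a local
ring `R`. -/
abbrev SpecialCodimOne [IsLocalRing R] (f : Y ⟶ Spec (CommRingCat.of R)) : Type u :=
  {y : CodimOne Y // f y.1 = closedPoint R}

/-- The resolvent divisor `r(ℱ, φ) = ∑_y v_y(ℱ_φ) y` of `ℱ = 𝒪_X(D)` at `φ`, where `y` runs over the
points of codimension one of `Y` contained in the special fibre. A formal rational combination of
such points is given by its coefficients. -/
def resolventDivisor [IsLocalRing R] (ρ : G →* Aut (Over.mk π)) (f : Y ⟶ Spec (CommRingCat.of R))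
    (D : Divisor X) (φ : G →* Rˣ) : SpecialCodimOne f → ℚ :=
  fun y => resolventValuation ρ f D φ y.1.1

/-- The divisor `0`, so that `𝒪_X(0) = 𝒪_X` is the structure sheaf. -/
def structureDivisor (X : Scheme.{u}) : Divisor X := 0

/-- The divisor `D_{X/Y} / 2 = ∑_x ((e_x - 1) / 2) x`, half of the different divisor
`D_{X/Y} = ∑_x (e_x - 1) x`. If all `e_x` are odd, the division is exact and
`𝒪_X(D_{X/Y} / 2) = ω_{X/Y}^{1/2}`. -/
def halfDifferent (ρ : G →* Aut (Over.mk π)) : Divisor X :=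
  fun x => ((ramIndex ρ x.1 : ℤ) - 1) / 2

open scoped Classical in
/-- The divisor `f(φ)`: the sum of the points `y` of codimension one of `Y` contained in the special
fibre with `n(φ, y) > 0`, where `n(φ, y) = n(φ, x)` for the points `x` above `y`. -/
def ramificationDivisor [IsLocalRing R] (ρ : G →* Aut (Over.mk π))
    (f : Y ⟶ Spec (CommRingCat.of R)) (φ : G →* Rˣ) : SpecialCodimOne f → ℚ :=
  fun y => if ∃ x : CodimOne X, π x.1 = y.1.1 ∧ 0 < cotangentExponent ρ f φ x.1 then 1 else 0

end Action

end ResolventDivisor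

end

/-! Everything is local at a point `y` of codimension one of `Y`. Let `x` lie above `y`, and write
`e = e_x` and `ν = n(φ, x)`. All three identities follow from one formula, `resolventValuation_eq`:
if `D` has constant coefficient `d ≥ 0` above `y`, the valuation of the resolvent is `ν / e - ⌊(ν +
d) / e⌋`. For `d = 0` this is `ν / e`; for `e = 2 d + 1` it is `ν / e`, diminished by `1` when `ν >
d`. What remains is arithmetic: `n(φ⁻¹, x)` is `e - ν`, or `0` if `ν = 0`, and `n(φ ^ 2, x)` is `2
ν` or `2 ν - e`.

The formula rests on tameness. The local rings above `y` are discrete valuation rings. An element of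
`I_x` that acts trivially on the cotangent line is the identity on `𝒪_{X,x}` (`eq_id_of_tame`),
hence lies in the inertia group of a generic point, which is trivial because the torsor locus is
dense. So `ψ_x` is injective (`cotangentCharacter_injective`), `I_x` is cyclic, and `φ` restricted
to `I_x` is a power of `ψ_x`.

A twisted trace `∑ φ(g)⁻¹ g(z b)` gives a `φ`-eigensection `u` of order exactly `ν` at `x`
(`exists_eigensection`). Independence of characters modulo `𝔪_x` reduces this to a sum over `I_x` of
terms congruent to `1`, that is to `e`, which is a unit. Taking `φ = 1` and order `e`, one finds
that a uniformizer `ϖ` of `y` has order `e` at `x` (`hasOrder_pullStalk`). By transitivity of `G` on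
the fibre, these orders are the same at all points above `y`.

Finally, the quotient of two `φ`-eigenvectors is invariant, and invariants integral above `y` come
from `𝒪_{Y,y}` (`exists_algebraMap_eq`). So the resolvent stalk is generated by `ϖ ^ (-j) u` with `j
= ⌊(ν + d) / e⌋` (`resolventStalk_eq_span`), and the `n`-th power of `u` comes from `Y`, with order
`ν n / e` at `y`. -/

noncomputable section

set_option linter.overlappingInstances false

namespace ResolventDivisor

/-! ### Orders of elements in local rings and discrete valuation rings. -/

section Order

variable {O : Type*} [CommRing O] [IsLocalRing O]

/-- The element `a` of a local ring generates the `k`-th power of the maximal ideal. -/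
def HasOrder (a : O) (k : ℕ) : Prop := Ideal.span {a} = maximalIdeal O ^ k

lemma HasOrder.mul {a b : O} {k l : ℕ} (ha : HasOrder a k) (hb : HasOrder b l) :
    HasOrder (a * b) (k + l) := by
  unfold HasOrder at *
  rw [← Ideal.span_singleton_mul_span_singleton, ha, hb, pow_add]

lemma HasOrder.pow {a : O} {k : ℕ} (ha : HasOrder a k) (n : ℕ) : HasOrder (a ^ n) (k * n) := by
  unfold HasOrder at *
  rw [← Ideal.span_singleton_pow, ha, pow_mul]

lemma hasOrder_zero_iff {a : O} : HasOrder a 0 ↔ IsUnit a := by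
  rw [HasOrder, pow_zero, Ideal.one_eq_top, Ideal.span_singleton_eq_top]

lemma HasOrder.mem {a : O} {k : ℕ} (ha : HasOrder a k) : a ∈ maximalIdeal O ^ k := by
  rw [← ha]; exact Ideal.mem_span_singleton_self a

lemma HasOrder.dvd {a b : O} {k : ℕ} (ha : HasOrder a k) (hb : b ∈ maximalIdeal O ^ k) : a ∣ b := by
  rw [← ha] at hb; exact Ideal.mem_span_singleton.mp hb

lemma HasOrder.mul_unit {a u : O} {k : ℕ} (ha : HasOrder a k) (hu : IsUnit u) :
    HasOrder (u * a) k := by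
  simpa using (hasOrder_zero_iff.mpr hu).mul ha

lemma HasOrder.map {O' : Type*} [CommRing O'] [IsLocalRing O'] (θ : O ≃+* O') {a : O} {k : ℕ}
    (ha : HasOrder a k) : HasOrder (θ a) k := by
  have := congrArg (Ideal.map (θ : O →+* O')) ha
  rw [Ideal.map_span, Ideal.map_pow, Set.image_singleton] at this
  rw [HasOrder, ← map_ringEquiv_maximalIdeal θ]
  exact this

lemma hasOrder_map_iff {O' : Type*} [CommRing O'] [IsLocalRing O'] (θ : O ≃+* O') {a : O} {k : ℕ} :
    HasOrder (θ a) k ↔ HasOrder a k :=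
  ⟨fun h => by simpa using h.map θ.symm, fun h => h.map θ⟩

lemma HasOrder.exists_unit [IsDomain O] {a b : O} {k : ℕ} (ha : HasOrder a k)
    (hb : HasOrder b k) : ∃ u : O, IsUnit u ∧ b = u * a := by
  obtain ⟨u, hu⟩ := Ideal.span_singleton_eq_span_singleton.mp (ha.trans hb.symm)
  exact ⟨u, u.isUnit, by rw [← hu, mul_comm]⟩

variable [IsDomain O] [IsDiscreteValuationRing O]

lemma exists_hasOrder_one : ∃ t : O, HasOrder t 1 := by
  obtain ⟨t, ht⟩ := IsDiscreteValuationRing.exists_irreducible O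
  exact ⟨t, by rw [HasOrder, pow_one, ht.maximalIdeal_eq]⟩

lemma HasOrder.ne_zero {a : O} {k : ℕ} (ha : HasOrder a k) : a ≠ 0 := by
  rintro rfl
  have h : maximalIdeal O ^ k = ⊥ := by rw [← ha]; simp
  exact pow_ne_zero k (IsDiscreteValuationRing.not_a_field O) h

lemma exists_hasOrder {a : O} (ha : a ≠ 0) : ∃ k, HasOrder a k := by
  obtain ⟨t, ht⟩ := IsDiscreteValuationRing.exists_irreducible O
  obtain ⟨k, u, rfl⟩ := IsDiscreteValuationRing.eq_unit_mul_pow_irreducible ha ht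
  refine ⟨k, HasOrder.mul_unit ?_ u.isUnit⟩
  rw [HasOrder, ← Ideal.span_singleton_pow, ht.maximalIdeal_eq]

lemma maximalIdeal_pow_le_iff {k l : ℕ} : maximalIdeal O ^ k ≤ maximalIdeal O ^ l ↔ l ≤ k := by
  refine ⟨fun h => ?_, Ideal.pow_le_pow_right⟩
  obtain ⟨t, ht⟩ := IsDiscreteValuationRing.exists_irreducible O
  rw [ht.maximalIdeal_eq, Ideal.span_singleton_pow, Ideal.span_singleton_pow,
    Ideal.span_singleton_le_span_singleton] at h
  exact (pow_dvd_pow_iff ht.ne_zero ht.not_isUnit).mp h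

lemma maximalIdeal_pow_inj {k l : ℕ} (h : maximalIdeal O ^ k = maximalIdeal O ^ l) : k = l :=
  le_antisymm (maximalIdeal_pow_le_iff.mp h.ge) (maximalIdeal_pow_le_iff.mp h.le)

lemma HasOrder.unique {a : O} {k l : ℕ} (h : HasOrder a k) (h' : HasOrder a l) : k = l :=
  maximalIdeal_pow_inj (h.symm.trans h')

lemma HasOrder.mem_iff {a : O} {k l : ℕ} (ha : HasOrder a k) : a ∈ maximalIdeal O ^ l ↔ l ≤ k := by
  rw [← maximalIdeal_pow_le_iff (O := O), ← ha, Ideal.span_singleton_le_iff_mem]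

end Order

/-! ### Regular local rings of dimension zero and one. -/

lemma maximalIdeal_isPrincipal_of_regular {O : Type*} [CommRing O] [IsRegularLocalRing O]
    (h : ringKrullDim O = 1) : (maximalIdeal O).IsPrincipal ∧ maximalIdeal O ≠ ⊥ := by
  have h1 := IsRegularLocalRing.spanFinrank_maximalIdeal (R := O)
  rw [h] at h1
  exact (Submodule.spanFinrank_eq_one_iff _).mp (by exact_mod_cast h1)

/-- A regular local ring of dimension one is a domain. -/
lemma isDomain_of_regular {O : Type*} [CommRing O] [IsRegularLocalRing O]
    (h : ringKrullDim O = 1) : IsDomain O := by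
  obtain ⟨t, ht⟩ := (maximalIdeal_isPrincipal_of_regular h).1
  rw [Ideal.submodule_span_eq] at ht
  -- If `t` were nilpotent, every prime would contain the maximal ideal and the dimension would be
  -- zero.
  have hnil : ∀ k, t ^ k ≠ 0 := by
    intro k hk
    have h0 : Ring.KrullDimLE 0 O := by
      rw [Ring.krullDimLE_zero_iff]
      intro p hp
      have : maximalIdeal O ≤ p := by
        rw [ht, Ideal.span_singleton_le_iff_mem]
        exact hp.mem_of_pow_mem k (hk ▸ zero_mem _)
      rw [← (maximalIdeal.isMaximal O).eq_of_le hp.ne_top this]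
      infer_instance
    rw [Ring.krullDimLE_iff, h] at h0
    exact absurd h0 (by norm_num)
  -- Krull's intersection theorem bounds the power of `t` that divides `a`.
  have key : ∀ a : O, a ≠ 0 → ∃ k, ∃ u : O, IsUnit u ∧ a = u * t ^ k := by
    intro a ha
    have hbot := Ideal.iInf_pow_eq_bot_of_isLocalRing (maximalIdeal O) (Ideal.IsPrime.ne_top')
    have : ∃ k, a ∉ maximalIdeal O ^ k := by
      by_contra! hc
      exact ha (by rw [← Ideal.mem_bot, ← hbot, Ideal.mem_iInf]; exact hc)
    classical
    obtain ⟨k, hk, hmin⟩ : ∃ k, a ∈ maximalIdeal O ^ k ∧ a ∉ maximalIdeal O ^ (k + 1) := by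
      by_contra! hc
      obtain ⟨k, hk⟩ := this
      exact hk (Nat.rec (by simp) (fun n hn => hc n hn) k)
    rw [ht, Ideal.span_singleton_pow, Ideal.mem_span_singleton] at hk
    obtain ⟨u, rfl⟩ := hk
    refine ⟨k, u, ?_, mul_comm _ _⟩
    by_contra hu
    refine hmin ?_
    rw [pow_succ]
    exact Ideal.mul_mem_mul (Ideal.pow_mem_pow (ht ▸ Ideal.mem_span_singleton_self t) k)
      ((mem_maximalIdeal u).mpr hu)
  have : NoZeroDivisors O := ⟨fun {a b} hab => by
    by_contra! hc
    obtain ⟨k, u, hu, rfl⟩ := key a hc.1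
    obtain ⟨l, w, hw, rfl⟩ := key b hc.2
    refine hnil (k + l) ((hu.mul hw).mul_left_eq_zero.mp ?_)
    rw [← hab, pow_add]; ring⟩
  exact NoZeroDivisors.to_isDomain O

lemma isDiscreteValuationRing_of_regular {O : Type*} [CommRing O] [IsDomain O]
    [IsRegularLocalRing O] (h : ringKrullDim O = 1) : IsDiscreteValuationRing O := by
  obtain ⟨h1, h2⟩ := maximalIdeal_isPrincipal_of_regular h
  exact ((IsDiscreteValuationRing.TFAE O (isField_iff_maximalIdeal_eq.not.mpr h2)).out 4 0).mp h1

lemma isField_of_regular {O : Type*} [CommRing O] [IsRegularLocalRing O]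
    (h : ringKrullDim O = 0) : IsField O := by
  have h1 := IsRegularLocalRing.spanFinrank_maximalIdeal (R := O)
  rw [h] at h1
  rw [isField_iff_maximalIdeal_eq]
  exact (Submodule.spanFinrank_eq_zero_iff_eq_bot (IsNoetherian.noetherian _)).mp
    (by exact_mod_cast h1)

/-! ### Two algebraic tools: tame endomorphisms and independence of characters. -/

/-- A ring endomorphism of finite order prime to the residue characteristic of a Noetherian local
ring, trivial on the residue field and on the cotangent space, is the identity. -/
lemma eq_id_of_tame {O : Type*} [CommRing O] [IsLocalRing O] [IsNoetherianRing O] (θ : O →+* O)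
    (h0 : ∀ a, θ a - a ∈ maximalIdeal O)
    (h1 : ∀ t ∈ maximalIdeal O, θ t - t ∈ maximalIdeal O ^ 2)
    (N : ℕ) (hN : IsUnit (N : O)) (hθ : ∀ a, θ^[N] a = a) (a : O) : θ a = a := by
  set m := maximalIdeal O
  -- `θ` is trivial on each graded piece `m ^ j / m ^ (j + 1)`, by the product rule applied to
  -- generators.
  have h2 : ∀ j, ∀ a ∈ m ^ j, θ a - a ∈ m ^ (j + 1) := by
    intro j
    induction j with
    | zero => intro a _; simpa using h0 a
    | succ j ih =>
      intro a ha
      rw [pow_succ] at ha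
      induction ha using Submodule.mul_induction_on' with
      | mem_mul_mem r hr s hs =>
        have hs' : θ s ∈ m := by simpa using add_mem (h0 s) hs
        have e : θ (r * s) - r * s = (θ r - r) * θ s + r * (θ s - s) := by rw [map_mul]; ring
        rw [e]
        refine add_mem ?_ ?_
        · rw [pow_succ]; exact Ideal.mul_mem_mul (ih r hr) hs'
        · rw [show j + 1 + 1 = j + 2 from rfl, pow_add]; exact Ideal.mul_mem_mul hr (h1 s hs)
      | add r _ s _ hr hs =>
        rw [map_add, show θ r + θ s - (r + s) = (θ r - r) + (θ s - s) by ring]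
        exact add_mem hr hs
  have h3 : ∀ j, ∀ a, θ a - a ∈ m ^ (j + 1) := by
    intro j
    induction j with
    | zero => intro a; simpa using h0 a
    | succ j ih =>
      intro a
      -- The difference `δ = θ a - a` lies in `m ^ (j + 1)`, so `θ` fixes it modulo `m ^ (j + 2)`
      -- and iteration is additive: `θ^[i] a ≡ a + i δ`. For `i = N` this gives `N δ ≡ 0`, with `N`
      -- a unit.
      have h4 : ∀ i : ℕ, θ^[i] a - (a + i * (θ a - a)) ∈ m ^ (j + 1 + 1) := by
        intro i
        induction i with
        | zero => simp
        | succ i hi =>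
          rw [Function.iterate_succ_apply']
          have e : θ (θ^[i] a) - (a + ((i + 1 : ℕ) : O) * (θ a - a)) =
              (θ (θ^[i] a - (a + i * (θ a - a))) - (θ^[i] a - (a + i * (θ a - a)))) +
              (θ^[i] a - (a + i * (θ a - a))) + i * (θ (θ a - a) - (θ a - a)) := by
            simp only [map_sub, map_add, map_mul, map_natCast, Nat.cast_add, Nat.cast_one]
            ring
          rw [e]
          exact add_mem (add_mem (Ideal.pow_le_pow_right (Nat.le_succ _) (h2 _ _ hi)) hi)
            (Ideal.mul_mem_left _ _ (h2 _ _ (ih a)))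
      have h5 := h4 N
      rw [hθ, sub_add_cancel_left, neg_mem_iff] at h5
      exact (Ideal.unit_mul_mem_iff_mem _ hN).mp h5
  have hbot := Ideal.iInf_pow_eq_bot_of_isLocalRing m Ideal.IsPrime.ne_top'
  rw [← sub_eq_zero, ← Ideal.mem_bot, ← hbot, Ideal.mem_iInf]
  intro j
  exact Ideal.pow_le_pow_right (Nat.le_succ j) (h3 j a)

open scoped Classical in
/-- Independence of characters: a combination of ring homomorphisms to a local ring takes a unit as a
value if the coefficients of those that agree with `γ g₀` modulo the maximal ideal sum up to a
unit. -/
lemma exists_isUnit_sum_of_sum_ne_zero {G B O : Type*} [Fintype G] [CommRing B] [CommRing O]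
    [IsLocalRing O] (γ : G → B →+* O) (c : G → O) (g₀ : G)
    (h : ∑ g with ∀ b, residue O (γ g b) = residue O (γ g₀ b), residue O (c g) ≠ 0) :
    ∃ b, IsUnit (∑ g, c g * γ g b) := by
  by_contra! hc
  let χ : G → (B →* ResidueField O) := fun g => ((residue O).comp (γ g) : B →* ResidueField O)
  have hsum : ∀ b, ∑ g, residue O (c g) * χ g b = 0 := by
    intro b
    have := (mem_maximalIdeal _).mpr (hc b)
    rw [← residue_eq_zero_iff, map_sum] at this
    simp only [map_mul] at this
    exact this
  -- Dedekind's independence, after grouping the indices `g` with the same reduction `χ g`: if no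
  -- value is a unit, every grouped coefficient vanishes.
  have hli := linearIndependent_monoidHom B (ResidueField O)
  rw [linearIndependent_iff'] at hli
  have := hli (Finset.univ.image χ) (fun f => ∑ g with χ g = f, residue O (c g)) (by
    funext b
    rw [Finset.sum_apply, Pi.zero_apply, ← hsum b]
    simp only [Pi.smul_apply, smul_eq_mul, Finset.sum_mul]
    rw [← Finset.sum_fiberwise_of_maps_to (s := Finset.univ) (t := Finset.univ.image χ) (g := χ)
      (fun g _ => Finset.mem_image_of_mem _ (Finset.mem_univ g))]
    refine Finset.sum_congr rfl fun f _ => Finset.sum_congr rfl fun g hg => ?_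
    rw [(Finset.mem_filter.mp hg).2]) (χ g₀) (Finset.mem_image_of_mem _ (Finset.mem_univ g₀))
  refine h ?_
  rw [← this]
  refine Finset.sum_congr (Finset.filter_congr fun g _ => ?_) fun _ _ => rfl
  exact ⟨fun h => MonoidHom.ext h, fun h b => DFunLike.congr_fun h b⟩

/-! ### Points of an affine open subset as prime ideals of its ring of sections. -/

section Affine

variable {Z : Scheme.{u}} {U : Z.Opens}

/-- The germ map of a scheme at a point of an open subset, as a ring homomorphism. -/
def germHom (U : Z.Opens) (z : Z) (hz : z ∈ U) : Γ(Z, U) →+* Z.presheaf.stalk z :=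
  (Z.presheaf.germ U z hz).hom

/-- The prime ideal of the sections on `U` that vanish at `z`. -/
def pointIdeal (U : Z.Opens) (z : Z) (hz : z ∈ U) : Ideal Γ(Z, U) :=
  (maximalIdeal (Z.presheaf.stalk z)).comap (germHom U z hz)

instance (z : Z) (hz : z ∈ U) : (pointIdeal U z hz).IsPrime :=
  inferInstanceAs (Ideal.comap _ _).IsPrime

lemma notMem_pointIdeal {z : Z} {hz : z ∈ U} {a : Γ(Z, U)} :
    a ∉ pointIdeal U z hz ↔ IsUnit (germHom U z hz a) := by
  rw [pointIdeal, Ideal.mem_comap, mem_maximalIdeal, mem_nonunits_iff, not_not]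

lemma mem_pointIdeal {z : Z} {hz : z ∈ U} {a : Γ(Z, U)} :
    a ∈ pointIdeal U z hz ↔ germHom U z hz a ∈ maximalIdeal (Z.presheaf.stalk z) := Iff.rfl

lemma stalkSpecializes_germHom {z η : Z} (h : η ⤳ z) (hz : z ∈ U) (hη : η ∈ U) (a : Γ(Z, U)) :
    Z.presheaf.stalkSpecializes h (germHom U z hz a) = germHom U η hη a :=
  congrArg (fun q => q.hom a) (TopCat.Presheaf.germ_stalkSpecializes Z.presheaf hz h)

lemma pointIdeal_mono {z η : Z} (h : η ⤳ z) (hz : z ∈ U) (hη : η ∈ U) :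
    pointIdeal U η hη ≤ pointIdeal U z hz := by
  intro a ha
  by_contra hc
  rw [notMem_pointIdeal] at hc
  have := hc.map (Z.presheaf.stalkSpecializes h).hom
  refine notMem_pointIdeal.mpr ?_ ha
  rw [← stalkSpecializes_germHom h hz hη]
  exact this

lemma exists_isAffineOpen_mem (z : Z) : ∃ U : Z.Opens, IsAffineOpen U ∧ z ∈ U := by
  obtain ⟨U, hU, hz, -⟩ := exists_isAffineOpen_mem_and_subset (x := z) (U := ⊤) trivial
  exact ⟨U, hU, hz⟩

variable (hU : IsAffineOpen U)
include hU

lemma isLocalization_germHom (z : Z) (hz : z ∈ U) :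
    @IsLocalization.AtPrime _ _ (Z.presheaf.stalk z) _ (germHom U z hz).toAlgebra
      (hU.primeIdealOf ⟨z, hz⟩).asIdeal _ :=
  hU.isLocalization_stalk ⟨z, hz⟩

lemma primeIdealOf_asIdeal (z : Z) (hz : z ∈ U) :
    (hU.primeIdealOf ⟨z, hz⟩).asIdeal = pointIdeal U z hz := by
  let := (germHom U z hz).toAlgebra
  have := isLocalization_germHom hU z hz
  exact (IsLocalization.AtPrime.under_maximalIdeal (Z.presheaf.stalk z)
    (hU.primeIdealOf ⟨z, hz⟩).asIdeal).symm

lemma exists_germHom_mul (z : Z) (hz : z ∈ U) (s : Z.presheaf.stalk z) :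
    ∃ d b : Γ(Z, U), IsUnit (germHom U z hz d) ∧ germHom U z hz d * s = germHom U z hz b := by
  let := (germHom U z hz).toAlgebra
  have := isLocalization_germHom hU z hz
  obtain ⟨⟨b, d⟩, h⟩ := IsLocalization.surj (hU.primeIdealOf ⟨z, hz⟩).asIdeal.primeCompl s
  refine ⟨d, b, IsLocalization.map_units (Z.presheaf.stalk z) d, ?_⟩
  rw [mul_comm]
  exact h

lemma exists_mul_eq_zero (z : Z) (hz : z ∈ U) {b : Γ(Z, U)} (hb : germHom U z hz b = 0) :
    ∃ d : Γ(Z, U), IsUnit (germHom U z hz d) ∧ d * b = 0 := by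
  let := (germHom U z hz).toAlgebra
  have := isLocalization_germHom hU z hz
  obtain ⟨d, h⟩ := (IsLocalization.map_eq_zero_iff (hU.primeIdealOf ⟨z, hz⟩).asIdeal.primeCompl
    (Z.presheaf.stalk z) b).mp hb
  exact ⟨d, IsLocalization.map_units (Z.presheaf.stalk z) d, h⟩

lemma germHom_ext {z : Z} (hz : z ∈ U) {T : Type*} [CommRing T] {f g : Z.presheaf.stalk z →+* T}
    (h : ∀ b, f (germHom U z hz b) = g (germHom U z hz b)) : f = g := by
  let := (germHom U z hz).toAlgebra
  have := isLocalization_germHom hU z hz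
  exact IsLocalization.ringHom_ext (hU.primeIdealOf ⟨z, hz⟩).asIdeal.primeCompl (RingHom.ext h)

lemma exists_pointIdeal_eq (p : Ideal Γ(Z, U)) [hp : p.IsPrime] :
    ∃ z, ∃ hz : z ∈ U, pointIdeal U z hz = p := by
  have hz : hU.fromSpec ⟨p, hp⟩ ∈ U := by
    have : hU.fromSpec ⟨p, hp⟩ ∈ Set.range hU.fromSpec := ⟨_, rfl⟩
    rwa [hU.range_fromSpec] at this
  refine ⟨hU.fromSpec ⟨p, hp⟩, hz, ?_⟩
  rw [← primeIdealOf_asIdeal hU]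
  have : hU.primeIdealOf ⟨_, hz⟩ = ⟨p, hp⟩ :=
    hU.fromSpec.isOpenEmbedding.injective (hU.fromSpec_primeIdealOf ⟨_, hz⟩)
  rw [this]

lemma specializes_of_pointIdeal_le {z η : Z} {hz : z ∈ U} {hη : η ∈ U}
    (h : pointIdeal U η hη ≤ pointIdeal U z hz) : η ⤳ z := by
  rw [← primeIdealOf_asIdeal hU, ← primeIdealOf_asIdeal hU] at h
  have := ((PrimeSpectrum.le_iff_specializes _ _).mp
    (show hU.primeIdealOf ⟨η, hη⟩ ≤ hU.primeIdealOf ⟨z, hz⟩ from h)).map hU.fromSpec.continuous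
  rwa [hU.fromSpec_primeIdealOf, hU.fromSpec_primeIdealOf] at this

lemma eq_of_pointIdeal_eq {z η : Z} {hz : z ∈ U} {hη : η ∈ U}
    (h : pointIdeal U η hη = pointIdeal U z hz) : η = z :=
  ((specializes_of_pointIdeal_le hU h.le).antisymm (specializes_of_pointIdeal_le hU h.ge)).eq

/-- After clearing denominators, a germ that dies at `η` is killed by a section invertible at `η`.
That section has nonzero germ at `z`, so it cancels in the domain. -/
lemma stalkSpecializes_injective {z η : Z} (h : η ⤳ z) (hz : z ∈ U)
    [IsDomain (Z.presheaf.stalk z)] : Function.Injective (Z.presheaf.stalkSpecializes h).hom := by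
  have hη : η ∈ U := h.mem_open U.isOpen hz
  rw [injective_iff_map_eq_zero]
  intro s hs
  obtain ⟨d, b, hd, hdb⟩ := exists_germHom_mul hU z hz s
  have hb : germHom U η hη b = 0 := by
    rw [← stalkSpecializes_germHom h hz hη, ← hdb, map_mul]
    erw [hs]
    rw [mul_zero]
  obtain ⟨c, hc, hcb⟩ := exists_mul_eq_zero hU η hη hb
  have h1 : germHom U z hz c * germHom U z hz b = 0 := by rw [← map_mul, hcb, map_zero]
  have hc0 : germHom U z hz c ≠ 0 := by
    intro h0
    rw [← stalkSpecializes_germHom h hz hη, h0, map_zero] at hc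
    exact not_isUnit_zero hc
  rw [← hdb] at h1
  exact hd.mul_right_eq_zero.mp ((mul_eq_zero.mp h1).resolve_left hc0)

omit hU in
lemma isField_stalk_of_generic (hZ : IsRegularScheme Z) {η : Z} (hη : ∀ z : Z, z ⤳ η → z = η) :
    IsField (Z.presheaf.stalk η) := by
  have := hZ.2 η
  refine isField_of_regular ?_
  rw [ringKrullDim_stalk_eq_coheight]
  have : Order.coheight η = 0 := by
    rw [Order.coheight_eq_zero]
    intro z hz
    rw [hη z hz]
  rw [this]; rfl

end Affine

/-! ### Fibres of the quotient morphism, and dimensions of local rings. -/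

section Cover

variable {G : Type v} [Group G] {X Y : Scheme.{u}} {π : X ⟶ Y} (ρ : G →* Aut (Over.mk π))

/-- The action of `G` by pullback of functions on the sections of `π_* 𝒪_X` on `U`. -/
def sectionAct (U : Y.Opens) (g : G) : Γ(X, π ⁻¹ᵁ U) →+* Γ(X, π ⁻¹ᵁ U) :=
  ((act ρ g).appLE (π ⁻¹ᵁ U) (π ⁻¹ᵁ U) (by rw [← Scheme.Hom.comp_preimage, act_comp])).hom

lemma stalkMap_germHom (U : Y.Opens) (g : G) (x : X) (hx : act ρ g x ∈ π ⁻¹ᵁ U)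
    (hx' : x ∈ π ⁻¹ᵁ U) (b : Γ(X, π ⁻¹ᵁ U)) :
    ((act ρ g).stalkMap x).hom (germHom _ _ hx b) = germHom _ x hx' (sectionAct ρ U g b) := by
  have : X.presheaf.germ (π ⁻¹ᵁ U) (act ρ g x) hx ≫ (act ρ g).stalkMap x =
      (act ρ g).appLE (π ⁻¹ᵁ U) (π ⁻¹ᵁ U) (by rw [← Scheme.Hom.comp_preimage, act_comp]) ≫
        X.presheaf.germ (π ⁻¹ᵁ U) x hx' := by
    rw [Scheme.Hom.germ_stalkMap, Scheme.Hom.appLE, Category.assoc, X.presheaf.germ_res']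
  exact congrArg (fun q => q.hom b) this

lemma pullStalk_germHom (U : Y.Opens) {x : X} {y : Y} (h : π x ⤳ y) (hy : y ∈ U)
    (hx : x ∈ π ⁻¹ᵁ U) (a : Γ(Y, U)) :
    pullStalk π h (germHom U y hy a) = germHom (π ⁻¹ᵁ U) x hx ((π.app U).hom a) := by
  have h1 := stalkSpecializes_germHom h hy (show π x ∈ U from hx) a
  have h2 : (π.stalkMap x).hom (germHom U (π x) hx a) = germHom (π ⁻¹ᵁ U) x hx ((π.app U).hom a) :=
    congrArg (fun q => q.hom a) (Scheme.Hom.germ_stalkMap π U x hx)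
  rw [← h2, ← h1]
  rfl

lemma sectionAct_one (U : Y.Opens) (b : Γ(X, π ⁻¹ᵁ U)) : sectionAct ρ U 1 b = b := by
  have : (act ρ (1 : G)).appLE (π ⁻¹ᵁ U) (π ⁻¹ᵁ U)
      (by rw [← Scheme.Hom.comp_preimage, act_comp]) = 𝟙 _ := by
    simp only [act_one]
    rw [Scheme.Hom.appLE, Scheme.Hom.id_app]
    exact (Category.id_comp _).trans (X.presheaf.map_id _)
  rw [sectionAct, this]
  rfl

/-- Pullback is contravariant, so this is a right action; the associated left action uses `g⁻¹`. -/
lemma sectionAct_mul (U : Y.Opens) (g h : G) (b : Γ(X, π ⁻¹ᵁ U)) :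
    sectionAct ρ U (g * h) b = sectionAct ρ U h (sectionAct ρ U g b) := by
  have e (k : G) : π ⁻¹ᵁ U ≤ (act ρ k) ⁻¹ᵁ (π ⁻¹ᵁ U) := by
    rw [← Scheme.Hom.comp_preimage, act_comp]
  have : (act ρ (g * h)).appLE (π ⁻¹ᵁ U) (π ⁻¹ᵁ U) (e _) =
      (act ρ g).appLE (π ⁻¹ᵁ U) (π ⁻¹ᵁ U) (e _) ≫
        (act ρ h).appLE (π ⁻¹ᵁ U) (π ⁻¹ᵁ U) (e _) := by
    rw [Scheme.Hom.appLE_comp_appLE]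
    simp only [act_mul]
  exact congrArg (fun q => q.hom b) this

lemma sectionAct_app (U : Y.Opens) (g : G) (a : Γ(Y, U)) :
    sectionAct ρ U g ((π.app U).hom a) = (π.app U).hom a := by
  have e : π ⁻¹ᵁ U ≤ (act ρ g) ⁻¹ᵁ (π ⁻¹ᵁ U) := by
    rw [← Scheme.Hom.comp_preimage, act_comp]
  have : π.app U ≫ (act ρ g).appLE (π ⁻¹ᵁ U) (π ⁻¹ᵁ U) e = π.app U := by
    rw [Scheme.Hom.app_eq_appLE, Scheme.Hom.appLE_comp_appLE]
    simp only [act_comp]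
  exact congrArg (fun q => q.hom a) this

lemma mem_preimage_act {U : Y.Opens} {x : X} (hx : x ∈ π ⁻¹ᵁ U) (g : G) :
    act ρ g x ∈ π ⁻¹ᵁ U := by
  change π (act ρ g x) ∈ U
  rw [π_act]; exact hx

/-- The isomorphism of local rings `𝒪_{X, gx} ≃ 𝒪_{X,x}` given by pullback along `g`. -/
def stalkEquiv (g : G) (x : X) : X.presheaf.stalk (act ρ g x) ≃+* X.presheaf.stalk x :=
  haveI : IsIso (act ρ g) := ⟨act ρ g⁻¹, comp_act_inv ρ g, act_inv_comp ρ g⟩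
  (asIso ((act ρ g).stalkMap x)).commRingCatIsoToRingEquiv

lemma stalkEquiv_germHom (U : Y.Opens) (g : G) (x : X) (hx : act ρ g x ∈ π ⁻¹ᵁ U)
    (hx' : x ∈ π ⁻¹ᵁ U) (b : Γ(X, π ⁻¹ᵁ U)) :
    stalkEquiv ρ g x (germHom _ _ hx b) = germHom _ x hx' (sectionAct ρ U g b) :=
  stalkMap_germHom ρ U g x hx hx' b

lemma stalkEquiv_pullStalk (g : G) (x : X) {y : Y} (h : π (act ρ g x) ⤳ y) (h' : π x ⤳ y)
    (a : Y.presheaf.stalk y) : stalkEquiv ρ g x (pullStalk π h a) = pullStalk π h' a :=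
  pullStalk_comp (act ρ g) π π (act_comp ρ g) h h' a

lemma mem_pointIdeal_act {U : Y.Opens} {x : X} (hx : x ∈ π ⁻¹ᵁ U) (g : G) (b : Γ(X, π ⁻¹ᵁ U)) :
    b ∈ pointIdeal (π ⁻¹ᵁ U) (act ρ g x) (mem_preimage_act ρ hx g) ↔
      sectionAct ρ U g b ∈ pointIdeal (π ⁻¹ᵁ U) x hx := by
  rw [← not_iff_not, notMem_pointIdeal, notMem_pointIdeal,
    ← stalkEquiv_germHom ρ U g x (mem_preimage_act ρ hx g) hx, MulEquiv.isUnit_map]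

/-- The left action of `G` on the sections of `π_* 𝒪_X` on `U`. -/
@[reducible] def sectionMulSemiringAction (U : Y.Opens) : MulSemiringAction G Γ(X, π ⁻¹ᵁ U) where
  smul g b := sectionAct ρ U g⁻¹ b
  one_smul b := by change sectionAct ρ U 1⁻¹ b = b; rw [inv_one, sectionAct_one]
  mul_smul g h b := by
    change sectionAct ρ U (g * h)⁻¹ b = sectionAct ρ U g⁻¹ (sectionAct ρ U h⁻¹ b)
    rw [mul_inv_rev, sectionAct_mul]
  smul_zero g := map_zero _
  smul_add g := map_add _
  smul_one g := map_one _
  smul_mul g := map_mul _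

variable (hcover : IsGCover ρ) {ρ}
include hcover

lemma IsGCover.exists_app_eq {U : Y.Opens} {b : Γ(X, π ⁻¹ᵁ U)}
    (hb : ∀ g, sectionAct ρ U g b = b) : ∃ a : Γ(Y, U), (π.app U).hom a = b :=
  (hcover.invariants U b hb).exists

lemma IsGCover.app_injective (U : Y.Opens) : Function.Injective (π.app U).hom := fun _ a' h =>
  (hcover.invariants U ((π.app U).hom a') fun g => sectionAct_app ρ U g a').unique h rfl

lemma IsGCover.isAffineOpen {U : Y.Opens} (hU : IsAffineOpen U) : IsAffineOpen (π ⁻¹ᵁ U) := by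
  have := hcover.finite
  exact hU.preimage π

lemma IsGCover.isIntegral {U : Y.Opens} (hU : IsAffineOpen U) : (π.app U).hom.IsIntegral := by
  have := hcover.finite
  exact (IsFinite.finite_app π U hU).to_isIntegral

omit hcover in
lemma comap_app_pointIdeal {U : Y.Opens} {x : X} (hx : x ∈ π ⁻¹ᵁ U) :
    (pointIdeal (π ⁻¹ᵁ U) x hx).comap (π.app U).hom =
      pointIdeal U (π x) (show π x ∈ U from hx) := by
  have hx' : π x ∈ U := hx
  ext a
  rw [Ideal.mem_comap, ← not_iff_not, notMem_pointIdeal, notMem_pointIdeal,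
    ← pullStalk_germHom U (specializes_refl (π x)) hx' hx]
  have : pullStalk π (specializes_refl (π x)) = (π.stalkMap x).hom := by
    simp [pullStalk]
  rw [this]
  exact isUnit_map_iff (π.stalkMap x).hom _

/-- An ideal which is not contained in any of the prime ideals of the points of `X` above `y` meets
the complement of the prime ideal of `y`. -/
lemma IsGCover.exists_isUnit_mem {U : Y.Opens} (hU : IsAffineOpen U) {y : Y} (hy : y ∈ U)
    (J : Ideal Γ(X, π ⁻¹ᵁ U))
    (hJ : ∀ x (hx : π x = y), ∃ d ∈ J, IsUnit (germHom (π ⁻¹ᵁ U) x (by rwa [← hx] at hy) d)) :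
    ∃ a : Γ(Y, U), IsUnit (germHom U y hy a) ∧ (π.app U).hom a ∈ J := by
  by_contra! hc
  algebraize [(π.app U).hom]
  have : Algebra.IsIntegral Γ(Y, U) Γ(X, π ⁻¹ᵁ U) := ⟨hcover.isIntegral hU⟩
  -- Lying over: an ideal that contracts into the prime of `y` is contained in a prime above it,
  -- that is in the prime of a point of the fibre.
  obtain ⟨Q, hQJ, hQ, hQy⟩ := Ideal.exists_ideal_over_prime_of_isIntegral (pointIdeal U y hy) J
    (fun a ha => by by_contra h; exact hc a (notMem_pointIdeal.mp h) ha)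
  obtain ⟨x, hx, rfl⟩ := exists_pointIdeal_eq (hcover.isAffineOpen hU) Q
  have hxy : π x = y := eq_of_pointIdeal_eq hU ((comap_app_pointIdeal hx).symm.trans hQy)
  obtain ⟨d, hdJ, hd⟩ := hJ x hxy
  exact notMem_pointIdeal.mpr hd (hQJ hdJ)

/-- Over an empty fibre the preceding criterion applies to the zero ideal, and yields an element of
the kernel of `π.app U` that is invertible at `y`, against injectivity. -/
lemma IsGCover.exists_apply_eq (y : Y) : ∃ x : X, π x = y := by
  obtain ⟨U, hU, hy⟩ := exists_isAffineOpen_mem y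
  by_contra! hc
  obtain ⟨a, ha, ha'⟩ := hcover.exists_isUnit_mem hU hy ⊥ fun x hx => absurd hx (hc x)
  have : a = 0 := hcover.app_injective U (by rw [map_zero]; exact ha')
  rw [this, map_zero] at ha
  exact not_isUnit_zero ha

/-- `G` acts transitively on the points of `X` above a given point of `Y`. -/
lemma IsGCover.exists_act_eq [Finite G] {x x' : X} (h : π x = π x') : ∃ g : G, act ρ g x = x' := by
  obtain ⟨U, hU, hy⟩ := exists_isAffineOpen_mem (π x)
  have hx : x ∈ π ⁻¹ᵁ U := hy
  have hx' : x' ∈ π ⁻¹ᵁ U := by change π x' ∈ U; rw [← h]; exact hy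
  algebraize [(π.app U).hom]
  let := sectionMulSemiringAction ρ U
  have : SMulCommClass G Γ(Y, U) Γ(X, π ⁻¹ᵁ U) := ⟨fun g a b => by
    rw [Algebra.smul_def, Algebra.smul_def]
    change sectionAct ρ U g⁻¹ _ = _ * sectionAct ρ U g⁻¹ b
    rw [map_mul]
    congr 1
    exact sectionAct_app ρ U g⁻¹ a⟩
  have : Algebra.IsInvariant Γ(Y, U) Γ(X, π ⁻¹ᵁ U) G := ⟨fun b hb =>
    hcover.exists_app_eq fun g => by simpa using (show sectionAct ρ U g⁻¹⁻¹ b = b from hb g⁻¹)⟩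
  obtain ⟨g, hg⟩ := Algebra.IsInvariant.exists_smul_of_under_eq Γ(Y, U) Γ(X, π ⁻¹ᵁ U) G
    (pointIdeal (π ⁻¹ᵁ U) x hx) (pointIdeal (π ⁻¹ᵁ U) x' hx') (by
      change Ideal.comap (π.app U).hom _ = Ideal.comap (π.app U).hom _
      rw [comap_app_pointIdeal, comap_app_pointIdeal]
      congr 1)
  refine ⟨g, eq_of_pointIdeal_eq (hcover.isAffineOpen hU) (hη := mem_preimage_act ρ hx g)
    (hz := hx') ?_⟩
  ext b
  rw [mem_pointIdeal_act, hg, Ideal.mem_pointwise_smul_iff_inv_smul_mem]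
  change _ ↔ sectionAct ρ U g⁻¹⁻¹ b ∈ _
  rw [inv_inv]

/-- Incomparability of primes in an integral extension. -/
lemma IsGCover.eq_of_specializes {z x : X} (h : z ⤳ x) (hπ : π z = π x) : z = x := by
  obtain ⟨U, hU, hy⟩ := exists_isAffineOpen_mem (π x)
  have hx : x ∈ π ⁻¹ᵁ U := hy
  have hz : z ∈ π ⁻¹ᵁ U := h.mem_open (π ⁻¹ᵁ U).isOpen hx
  algebraize [(π.app U).hom]
  have : Algebra.IsIntegral Γ(Y, U) Γ(X, π ⁻¹ᵁ U) := ⟨hcover.isIntegral hU⟩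
  refine eq_of_pointIdeal_eq (hcover.isAffineOpen hU) (hη := hz) (hz := hx) ?_
  by_contra hne
  have hlt := Ideal.IsIntegral.comap_lt_comap (R := Γ(Y, U))
    (lt_of_le_of_ne (pointIdeal_mono h hx hz) hne)
  change Ideal.comap (π.app U).hom _ < Ideal.comap (π.app U).hom _ at hlt
  rw [comap_app_pointIdeal, comap_app_pointIdeal] at hlt
  refine hlt.ne ?_
  congr 1

lemma IsGCover.specializingMap : SpecializingMap π := by
  have := hcover.finite
  exact π.isClosedMap.specializingMap

/-- The dimension is the coheight for specialization. It does not grow from `x` to less than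
expected: `π` is strictly monotone by incomparability, so it is at most one. It is not zero, because
a proper generization of `π x` lifts to some `z`, which specializes into the fibre since `π` is
closed, and a conjugate of `z` then specializes to `x`. -/
lemma IsGCover.ringKrullDim_stalk_eq_one [Finite G] {x : X}
    (hy : ringKrullDim (Y.presheaf.stalk (π x)) = 1) : ringKrullDim (X.presheaf.stalk x) = 1 := by
  rw [ringKrullDim_stalk_eq_coheight] at hy ⊢
  have hy : Order.coheight (π x) = 1 := by exact_mod_cast hy
  have hmono : StrictMono (π : X → Y) := fun a b hab => by
    have h : b ⤳ a := hab.le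
    have hle : π a ≤ π b := h.map π.continuous
    refine lt_of_le_not_ge hle fun (hge : π a ⤳ π b) => hab.ne ?_
    exact (hcover.eq_of_specializes h (hge.antisymm hle).eq.symm).symm
  have h1 : Order.coheight x ≤ 1 := hy ▸ Order.coheight_le_coheight_apply_of_strictMono π hmono x
  have h2 : Order.coheight x ≠ 0 := by
    intro h0
    rw [Order.coheight_eq_zero] at h0
    have h3 : ¬ IsMax (π x) := by rw [← Order.coheight_eq_zero, hy]; exact one_ne_zero
    rw [not_isMax_iff] at h3
    obtain ⟨ξ, hξ⟩ := h3
    obtain ⟨z, rfl⟩ := hcover.exists_apply_eq ξ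
    obtain ⟨x', hx', hxx'⟩ := hcover.specializingMap (show π z ⤳ π x from hξ.le)
    obtain ⟨g, rfl⟩ := hcover.exists_act_eq hxx'
    have h4 : act ρ g z ⤳ act ρ g x' := hx'.map (act ρ g).continuous
    have h5 : act ρ g x' ⤳ act ρ g z := h0 (show act ρ g x' ≤ act ρ g z from h4)
    refine hξ.ne ?_
    rw [(h5.antisymm h4).eq, π_act]
  have : Order.coheight x = 1 := le_antisymm h1 (Order.one_le_iff_ne_zero.mpr h2)
  rw [this]; rfl

end Cover

/-! ### Inertia groups on affine charts; triviality over the torsor locus. -/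

section Inertia

lemma hom_ext_of_appLE {Z T : Scheme.{u}} [IsAffine T] {W : Z.Opens} (hW : IsAffineOpen W)
    {p q : T ⟶ Z} (hp : ⊤ ≤ p ⁻¹ᵁ W) (hq : ⊤ ≤ q ⁻¹ᵁ W) (h : p.appLE W ⊤ hp = q.appLE W ⊤ hq) :
    p = q := by
  have hT := isAffineOpen_top T
  have : IsIso hT.fromSpec := by
    rw [IsAffineOpen.fromSpec_top]
    infer_instance
  rw [← cancel_epi hT.fromSpec, ← IsAffineOpen.SpecMap_appLE_fromSpec p hW hT hp,
    ← IsAffineOpen.SpecMap_appLE_fromSpec q hW hT hq, h]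

lemma le_preimage_fromSpecResidueField {Z : Scheme.{u}} {W : Z.Opens} {z : Z} (hz : z ∈ W) :
    ⊤ ≤ Z.fromSpecResidueField z ⁻¹ᵁ W := by
  intro s _
  change Z.fromSpecResidueField z s ∈ W
  rwa [Scheme.fromSpecResidueField_apply]

lemma fromSpecResidueField_appLE {Z : Scheme.{u}} {W : Z.Opens} {z : Z} (hz : z ∈ W) :
    (Z.fromSpecResidueField z).appLE W ⊤ (le_preimage_fromSpecResidueField hz) =
      Z.presheaf.germ W z hz ≫ Z.residue z ≫ (Scheme.ΓSpecIso (Z.residueField z)).inv := by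
  have h : ⊤ ≤ Z.fromSpecStalk z ⁻¹ᵁ W := by
    intro s _
    have : Z.fromSpecStalk z s ⤳ z := by
      have : Z.fromSpecStalk z s ∈ Set.range (Z.fromSpecStalk z) := ⟨s, rfl⟩
      rwa [Scheme.range_fromSpecStalk] at this
    exact this.mem_open W.isOpen hz
  have h1 : (Z.fromSpecStalk z).appLE W ⊤ h =
      Z.presheaf.germ W z hz ≫ (Scheme.ΓSpecIso (Z.presheaf.stalk z)).inv := by
    rw [Scheme.Hom.appLE, Scheme.fromSpecStalk_app hz, Category.assoc, Category.assoc,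
      ← Functor.map_comp]
    congr 1
  have h2 : (Spec.map (Z.residue z) ≫ Z.fromSpecStalk z).appLE W ⊤
      (show ⊤ ≤ (Spec.map (Z.residue z) ≫ Z.fromSpecStalk z) ⁻¹ᵁ W from
        le_preimage_fromSpecResidueField hz) =
      (Z.fromSpecStalk z).appLE W ⊤ h ≫ (Spec.map (Z.residue z)).appLE ⊤ ⊤ le_top :=
    (Scheme.Hom.appLE_comp_appLE (Spec.map (Z.residue z)) (Z.fromSpecStalk z) W ⊤ ⊤ h le_top).symm
  refine h2.trans ?_
  rw [h1, Category.assoc, Scheme.ΓSpecIso_inv_naturality]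
  rw [Scheme.Hom.appTop, Scheme.Hom.app_eq_appLE]
  rfl

variable {G : Type v} [Group G] {X Y : Scheme.{u}} {π : X ⟶ Y} {ρ : G →* Aut (Over.mk π)}

/-- A morphism from `Spec κ(x)` into an affine open subset is determined by the pullback of
sections. -/
lemma mem_inertia_iff {U : Y.Opens} (hW : IsAffineOpen (π ⁻¹ᵁ U)) {x : X} (hx : x ∈ π ⁻¹ᵁ U)
    (g : G) : g ∈ inertia ρ x ↔ ∀ b, residue _ (germHom (π ⁻¹ᵁ U) x hx (sectionAct ρ U g b)) =
      residue _ (germHom (π ⁻¹ᵁ U) x hx b) := by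
  have e : π ⁻¹ᵁ U ≤ (act ρ g) ⁻¹ᵁ (π ⁻¹ᵁ U) := by
    rw [← Scheme.Hom.comp_preimage, act_comp]
  have h1 : ⊤ ≤ (X.fromSpecResidueField x ≫ act ρ g) ⁻¹ᵁ (π ⁻¹ᵁ U) :=
    (le_preimage_fromSpecResidueField hx).trans fun s hs => e hs
  have h2 : (X.fromSpecResidueField x ≫ act ρ g).appLE (π ⁻¹ᵁ U) ⊤ h1 =
      (act ρ g).appLE _ _ e ≫ X.presheaf.germ _ x hx ≫ X.residue x ≫
        (Scheme.ΓSpecIso (X.residueField x)).inv := by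
    rw [← fromSpecResidueField_appLE, Scheme.Hom.appLE_comp_appLE]
  have h3 : g ∈ inertia ρ x ↔ (X.fromSpecResidueField x ≫ act ρ g).appLE (π ⁻¹ᵁ U) ⊤ h1 =
      (X.fromSpecResidueField x).appLE (π ⁻¹ᵁ U) ⊤ (le_preimage_fromSpecResidueField hx) := by
    refine ⟨fun h => ?_, fun h => hom_ext_of_appLE hW _ _ h⟩
    have h : X.fromSpecResidueField x ≫ act ρ g = X.fromSpecResidueField x := h
    simp only [h]
  rw [h3, h2, fromSpecResidueField_appLE, ← Category.assoc, ← Category.assoc, ← Category.assoc,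
    cancel_mono]
  constructor
  · intro h b
    exact congrArg (fun q => q.hom b) h
  · intro h
    ext b
    exact h b

/-- For `g` in `I_x`, the copies of `x` with indices `g` and `1` have the same image in `X ×_Y X`,
since `(x, g x)` and `(x, x)` agree as `κ(x)`-points. Over `V` the action map is injective, so the
indices agree. -/
lemma eq_one_of_mem_inertia_of_isIso [Finite G] {V : Y.Opens}
    (hV : IsIso (actionMap ρ ∣_ ((pullback.fst π π ≫ π) ⁻¹ᵁ V))) {x : X} (hx : π x ∈ V) {g : G}
    (hg : g ∈ inertia ρ x) : g = 1 := by
  have hg' : X.fromSpecResidueField x ≫ act ρ g = X.fromSpecResidueField x := hg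
  let ι (k : G) : X ⟶ ∐ fun _ : G => X := Sigma.ι (fun _ : G => X) k
  have h1 (k : G) : ι k ≫ actionMap ρ =
      pullback.lift (𝟙 X) (act ρ k) (by rw [act_comp, Category.id_comp]) := by
    simp [actionMap, ι]
  have h2 : X.fromSpecResidueField x ≫ ι g ≫ actionMap ρ =
      X.fromSpecResidueField x ≫ ι 1 ≫ actionMap ρ := by
    rw [h1, h1]
    apply pullback.hom_ext
    · rw [Category.assoc, Category.assoc, pullback.lift_fst, pullback.lift_fst]
    · rw [Category.assoc, Category.assoc, pullback.lift_snd, pullback.lift_snd, hg', act_one,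
        Category.comp_id]
  have h3 : actionMap ρ (ι g x) = actionMap ρ (ι 1 x) := by
    have h : X.fromSpecResidueField x (closedPoint (X.residueField x)) = x :=
      Scheme.fromSpecResidueField_apply x _
    have h' : actionMap ρ (ι g (X.fromSpecResidueField x (closedPoint (X.residueField x)))) =
        actionMap ρ (ι 1 (X.fromSpecResidueField x (closedPoint (X.residueField x)))) :=
      congrArg (fun q => q (closedPoint (X.residueField x))) h2
    rwa [h] at h'
  set T := (pullback.fst π π ≫ π) ⁻¹ᵁ V
  have h4 (k : G) : actionMap ρ (ι k x) ∈ T := by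
    change (pullback.fst π π ≫ π) (actionMap ρ (ι k x)) ∈ V
    rw [← Scheme.Hom.comp_apply, ← Scheme.Hom.comp_apply, ← Category.assoc, h1,
      pullback.lift_fst_assoc, Category.id_comp]
    exact hx
  have h5 : (⟨ι g x, h4 g⟩ : ↥(actionMap ρ ⁻¹ᵁ T)) = ⟨ι 1 x, h4 1⟩ := by
    apply (actionMap ρ ∣_ T).homeomorph.injective
    apply Subtype.ext
    exact (morphismRestrict_base_coe (actionMap ρ) T ⟨ι g x, h4 g⟩).trans
      (h3.trans (morphismRestrict_base_coe (actionMap ρ) T ⟨ι 1 x, h4 1⟩).symm)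
  have h6 : ι g x = ι 1 x := congrArg Subtype.val h5
  exact congrArg Sigma.fst ((sigmaι_eq_iff (fun _ : G => X) g 1 x x).mp h6)

/-- A point without proper generizations of a regular scheme lies in every dense open
subset. -/
lemma mem_of_dense_of_generic {Y : Scheme.{u}} (hY : IsRegularScheme Y) {ξ : Y}
    (hξ : ∀ z : Y, z ⤳ ξ → z = ξ) {V : Y.Opens} (hV : Dense (V : Set Y)) : ξ ∈ V := by
  have := hY.1
  classical
  obtain ⟨U, hU, hξU⟩ := exists_isAffineOpen_mem ξ
  have hnoeth : IsNoetherianRing Γ(Y, U) := IsLocallyNoetherian.component_noetherian ⟨U, hU⟩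
  have hfield := isField_stalk_of_generic hY hξ
  have hzero : ∀ b ∈ pointIdeal U ξ hξU, germHom U ξ hξU b = 0 := by
    intro b hb
    by_contra h0
    obtain ⟨c, hc⟩ := hfield.mul_inv_cancel h0
    exact notMem_pointIdeal.mpr (IsUnit.of_mul_eq_one _ hc) hb
  obtain ⟨s, hs⟩ := IsNoetherian.noetherian (pointIdeal U ξ hξU)
  have : ∀ b ∈ pointIdeal U ξ hξU, ∃ d, IsUnit (germHom U ξ hξU d) ∧ d * b = 0 := fun b hb =>
    exists_mul_eq_zero hU ξ hξU (hzero b hb)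
  choose! d hd hdb using this
  have hs' : ∀ b ∈ s, b ∈ pointIdeal U ξ hξU := fun b hb => hs ▸ Submodule.subset_span hb
  -- Where `f` is invertible, all generators of the prime of `ξ` vanish. So every point of this
  -- neighbourhood is a specialization of `ξ`, and one of them lies in `V`.
  let f := ∏ b ∈ s, d b
  have hf : ξ ∈ Y.basicOpen f := by
    rw [Y.mem_basicOpen f ξ hξU]
    change IsUnit (germHom U ξ hξU f)
    rw [map_prod, IsUnit.prod_iff]
    exact fun b hb => hd b (hs' b hb)
  obtain ⟨z, hz, hzV⟩ := hV.inter_open_nonempty _ (Y.basicOpen f).isOpen ⟨ξ, hf⟩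
  have hzU : z ∈ U := Y.basicOpen_le f hz
  have hfz : IsUnit (germHom U z hzU f) := (Y.mem_basicOpen f z hzU).mp hz
  refine (specializes_of_pointIdeal_le hU (hη := hξU) (hz := hzU) ?_).mem_open V.isOpen hzV
  rw [← hs, Submodule.span_le]
  intro b hb
  by_contra hc
  have h1 := (notMem_pointIdeal.mp hc).mul hfz
  have h2 : b * f = 0 := by
    simp only [f]
    rw [← Finset.prod_erase_mul s d hb, mul_left_comm, mul_comm b, hdb b (hs' b hb), mul_zero]
  rw [← map_mul, h2, map_zero] at h1
  exact not_isUnit_zero h1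

/-- A proper generization of a point of codimension one has no proper generizations. -/
lemma generic_of_specializes_of_ne {Y : Scheme.{u}} {y z : Y}
    (hy : ringKrullDim (Y.presheaf.stalk y) = 1) (h : z ⤳ y) (hne : z ≠ y) :
    ∀ w : Y, w ⤳ z → w = z := by
  intro w hw
  rw [ringKrullDim_stalk_eq_coheight] at hy
  have hy : Order.coheight y = 1 := by exact_mod_cast hy
  have h1 : y < z := lt_of_le_not_ge h fun (h' : y ⤳ z) => hne (h.antisymm h').eq
  have h2 : Order.coheight z < (1 : ℕ) := Order.coheight_le_coe_iff.mp (by rw [hy]; rfl) z h1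
  have h3 : IsMax z := by
    rw [← Order.coheight_eq_zero]
    simpa using h2
  exact (hw.antisymm (h3 (show z ≤ w from hw))).eq

end Inertia

/-! ### The action of inertia on the local ring and on its cotangent line. -/

section CotangentCharacter

variable {G : Type v} [Group G] {X Y : Scheme.{u}} {π : X ⟶ Y} {ρ : G →* Aut (Over.mk π)}

lemma inertiaAct_germHom {U : Y.Opens} {x : X} (hx : x ∈ π ⁻¹ᵁ U) (g : inertia ρ x)
    (b : Γ(X, π ⁻¹ᵁ U)) : inertiaAct ρ x g (germHom _ x hx b) =
      germHom _ x hx (sectionAct ρ U g.1 b) := by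
  rw [← stalkMap_germHom ρ U g.1 x (mem_preimage_act ρ hx g.1) hx,
    ← stalkSpecializes_germHom (specializes_of_eq (inertia_fix ρ g.2)) hx]
  rfl

/-- Every point of `Y` has an affine open neighbourhood with affine preimage in `X`. -/
lemma IsGCover.exists_affine (hcover : IsGCover ρ) (y : Y) :
    ∃ U : Y.Opens, IsAffineOpen U ∧ IsAffineOpen (π ⁻¹ᵁ U) ∧ y ∈ U := by
  obtain ⟨U, hU, hy⟩ := exists_isAffineOpen_mem y
  exact ⟨U, hU, hcover.isAffineOpen hU, hy⟩

variable (hcover : IsGCover ρ) {x : X}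
include hcover

lemma inertiaAct_one (a : X.presheaf.stalk x) : inertiaAct ρ x 1 a = a := by
  obtain ⟨U, hU, hW, hy⟩ := hcover.exists_affine (π x)
  have hy : x ∈ π ⁻¹ᵁ U := hy
  have : inertiaAct ρ x 1 = RingHom.id _ := germHom_ext hW hy fun b => by
    rw [inertiaAct_germHom]
    simp [sectionAct_one]
  rw [this]; rfl

lemma inertiaAct_mul (g h : inertia ρ x) (a : X.presheaf.stalk x) :
    inertiaAct ρ x (g * h) a = inertiaAct ρ x h (inertiaAct ρ x g a) := by
  obtain ⟨U, hU, hW, hy⟩ := hcover.exists_affine (π x)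
  have hy : x ∈ π ⁻¹ᵁ U := hy
  have : inertiaAct ρ x (g * h) = (inertiaAct ρ x h).comp (inertiaAct ρ x g) :=
    germHom_ext hW hy fun b => by
      rw [RingHom.comp_apply, inertiaAct_germHom, inertiaAct_germHom, inertiaAct_germHom]
      simp [sectionAct_mul]
  rw [this]; rfl

lemma inertiaAct_pow (g : inertia ρ x) (n : ℕ) (a : X.presheaf.stalk x) :
    inertiaAct ρ x (g ^ n) a = (inertiaAct ρ x g)^[n] a := by
  induction n with
  | zero => rw [pow_zero, inertiaAct_one hcover]; rfl
  | succ n ih => rw [pow_succ, inertiaAct_mul hcover, ih, Function.iterate_succ_apply']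

lemma residue_inertiaAct (g : inertia ρ x) (a : X.presheaf.stalk x) :
    residue _ (inertiaAct ρ x g a) = residue _ a := by
  obtain ⟨U, hU, hW, hy⟩ := hcover.exists_affine (π x)
  have hy : x ∈ π ⁻¹ᵁ U := hy
  have : (residue _).comp (inertiaAct ρ x g) = residue (X.presheaf.stalk x) :=
    germHom_ext hW hy fun b => by
      rw [RingHom.comp_apply, inertiaAct_germHom]
      exact (mem_inertia_iff hW hy g.1).mp g.2 b
  exact congrArg (fun q => q a) this

lemma inertiaAct_sub_mem (g : inertia ρ x) (a : X.presheaf.stalk x) :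
    inertiaAct ρ x g a - a ∈ maximalIdeal (X.presheaf.stalk x) := by
  rw [← residue_eq_zero_iff, map_sub, residue_inertiaAct hcover, sub_self]

variable [IsDomain (X.presheaf.stalk x)] [IsDiscreteValuationRing (X.presheaf.stalk x)]

/-- With a uniformizer `t` and `g t = l_g t`, the character is the residue of `l_g`. The cocycle
rule `l_{gh} = h(l_g) l_h` becomes multiplicativity since inertia acts trivially on residues. In
particular the default value `1` is not taken. -/
lemma isCotangentCharacter_cotangentCharacter :
    IsCotangentCharacter ρ x (cotangentCharacter ρ x) := by
  have hex : ∃ ψ, IsCotangentCharacter ρ x ψ := by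
    obtain ⟨t, ht⟩ := exists_hasOrder_one (O := X.presheaf.stalk x)
    have ht0 := ht.ne_zero
    have htm : t ∈ maximalIdeal (X.presheaf.stalk x) := by simpa using ht.mem
    have hl (g : inertia ρ x) : ∃ l, inertiaAct ρ x g t = l * t := by
      have : inertiaAct ρ x g t ∈ maximalIdeal (X.presheaf.stalk x) := by
        simpa using add_mem (inertiaAct_sub_mem hcover g t) htm
      obtain ⟨l, hl⟩ := ht.dvd (by simpa using this)
      exact ⟨l, by rw [hl, mul_comm]⟩
    choose l hl using hl
    let ψ : inertia ρ x →* X.residueField x :=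
      { toFun := fun g => residue _ (l g)
        map_one' := by
          have : l 1 = 1 := mul_right_cancel₀ ht0 (by
            rw [← hl, inertiaAct_one hcover, one_mul])
          rw [this, map_one]; rfl
        map_mul' := fun g h => by
          have : l (g * h) = inertiaAct ρ x h (l g) * l h := mul_right_cancel₀ ht0 (by
            rw [← hl, inertiaAct_mul hcover, hl, map_mul, hl, mul_assoc])
          rw [this, map_mul, residue_inertiaAct hcover]; rfl }
    refine ⟨ψ.toHomUnits, fun g a s ha hs => ?_⟩
    obtain ⟨b, rfl⟩ := ht.dvd (by simpa using hs)
    have e : inertiaAct ρ x g (t * b) - a * (t * b) =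
        (l g * inertiaAct ρ x g b - a * b) * t := by rw [map_mul, hl]; ring
    have ha' : residue _ a = residue _ (l g) := ha
    rw [e, pow_two]
    refine Ideal.mul_mem_mul ?_ htm
    rw [← residue_eq_zero_iff, map_sub, map_mul, map_mul, residue_inertiaAct hcover, ha', sub_self]
  rw [cotangentCharacter, dif_pos hex]
  exact hex.choose_spec

/-- The inertia group acts on elements of order `k` by the `k`-th power of the cotangent
character. -/
lemma inertiaAct_of_hasOrder (g : inertia ρ x) {z : X.presheaf.stalk x} {k : ℕ}
    (hz : HasOrder z k) : ∃ l, inertiaAct ρ x g z = l * z ∧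
      X.residue x l = (cotangentCharacter ρ x g : X.residueField x) ^ k := by
  obtain ⟨t, ht⟩ := exists_hasOrder_one (O := X.presheaf.stalk x)
  obtain ⟨a, ha⟩ := X.residue_surjective x (cotangentCharacter ρ x g : X.residueField x)
  have h1 := isCotangentCharacter_cotangentCharacter hcover g a t ha (by simpa using ht.mem)
  obtain ⟨c, hc⟩ := (show HasOrder (t ^ 2) 2 by simpa using ht.pow 2).dvd h1
  obtain ⟨w, hw, hwz⟩ := (show HasOrder (t ^ k) k by simpa using ht.pow k).exists_unit hz
  obtain ⟨w', hw'⟩ := hw.exists_right_inv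
  -- Here `z = w t ^ k` and `g t = (a + c t) t`; the unit `w` contributes `g(w) / w`, whose residue
  -- is `1`.
  refine ⟨inertiaAct ρ x g w * w' * (a + c * t) ^ k, ?_, ?_⟩
  · have e : inertiaAct ρ x g t = (a + c * t) * t := by
      rw [← sub_add_cancel (inertiaAct ρ x g t) (a * t), hc]; ring
    rw [hwz, map_mul, map_pow, e]
    calc _ = inertiaAct ρ x g w * ((a + c * t) * t) ^ k * (w * w') := by rw [hw', mul_one]
      _ = _ := by rw [mul_pow]; ring
  · have h2 : residue _ (inertiaAct ρ x g w * w') = 1 := by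
      rw [map_mul, residue_inertiaAct hcover, ← map_mul, hw', map_one]
    have h3 : residue _ (a + c * t) = residue _ a := by
      have : residue (X.presheaf.stalk x) t = 0 :=
        (residue_eq_zero_iff t).mpr (by simpa using ht.mem)
      rw [map_add, map_mul, this, mul_zero, add_zero]
    rw [← ha]
    change residue _ _ = residue _ a ^ k
    rw [map_mul, h2, one_mul, map_pow, h3]

end CotangentCharacter

/-! ### Existence of generic generizations. -/

section Generic

lemma exists_generic_specializes {X : Scheme.{u}} (x : X) :
    ∃ η : X, η ⤳ x ∧ ∀ z : X, z ⤳ η → z = η := by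
  obtain ⟨W, hW, hx⟩ := exists_isAffineOpen_mem x
  obtain ⟨p, hp, hpx⟩ := Ideal.exists_minimalPrimes_le (bot_le (a := pointIdeal W x hx))
  have := hp.1.1
  obtain ⟨η, hη, rfl⟩ := exists_pointIdeal_eq hW p
  refine ⟨η, specializes_of_pointIdeal_le hW hpx, fun z hz => ?_⟩
  have hzW := hz.mem_open W.isOpen hη
  refine (hz.antisymm (specializes_of_pointIdeal_le hW (hη := hη) (hz := hzW) ?_)).eq
  exact hp.2 ⟨inferInstance, bot_le⟩ (pointIdeal_mono hz hη hzW)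

end Generic

/-! ### Faithfulness of the cotangent character and arithmetic of the exponents. -/

section Tame

variable {G : Type v} [Group G] [Finite G] {X Y : Scheme.{u}} {π : X ⟶ Y}
  {ρ : G →* Aut (Over.mk π)} (hcover : IsGCover ρ) (hX : IsRegularScheme X) {x : X}
include hcover hX

lemma IsGCover.isDomain_stalk (hy : ringKrullDim (Y.presheaf.stalk (π x)) = 1) :
    IsDomain (X.presheaf.stalk x) := by
  have := hX.2 x
  exact isDomain_of_regular (hcover.ringKrullDim_stalk_eq_one hy)

lemma IsGCover.isDiscreteValuationRing_stalk [IsDomain (X.presheaf.stalk x)]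
    (hy : ringKrullDim (Y.presheaf.stalk (π x)) = 1) :
    IsDiscreteValuationRing (X.presheaf.stalk x) := by
  have := hX.2 x
  exact isDiscreteValuationRing_of_regular (hcover.ringKrullDim_stalk_eq_one hy)

lemma IsGCover.ne_of_generic (hy : ringKrullDim (Y.presheaf.stalk (π x)) = 1) {η : X}
    (hη : ∀ z : X, z ⤳ η → z = η) : π η ≠ π x := by
  intro h
  have := hcover.isDomain_stalk hX (x := η) (by rw [h]; exact hy)
  have := hcover.isDiscreteValuationRing_stalk hX (x := η) (by rw [h]; exact hy)
  exact IsDiscreteValuationRing.not_isField _ (isField_stalk_of_generic hX hη)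

variable (hY : IsRegularScheme Y) (htorsor : IsGenericallyTorsor ρ)
  (hy : ringKrullDim (Y.presheaf.stalk (π x)) = 1)
  (hn : IsUnit ((Monoid.exponent G : ℕ) : X.presheaf.stalk x))
include hY htorsor hy hn

/-- An element of the kernel acts trivially on the local ring by tameness, hence on the residue
field of a generic `η` specializing to `x`. As `η` lies over the torsor locus, the element is `1`.
-/
lemma cotangentCharacter_injective : Function.Injective (cotangentCharacter ρ x) := by
  have := hcover.isDomain_stalk hX hy
  have := hcover.isDiscreteValuationRing_stalk hX hy
  rw [injective_iff_map_eq_one]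
  intro g hg
  have hid : ∀ a, inertiaAct ρ x g a = a := by
    refine eq_id_of_tame _ (inertiaAct_sub_mem hcover g) (fun t ht => ?_) _ hn (fun a => ?_)
    · have := isCotangentCharacter_cotangentCharacter hcover g 1 t (by rw [hg, map_one]; rfl) ht
      rwa [one_mul] at this
    · have : g ^ Monoid.exponent G = 1 := Subtype.ext (Monoid.pow_exponent_eq_one g.1)
      rw [← inertiaAct_pow hcover, this, inertiaAct_one hcover]
  obtain ⟨η, hηx, hη⟩ := exists_generic_specializes x
  obtain ⟨V, hV, -, -, hiso⟩ := htorsor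
  obtain ⟨U, hU, hW, hxU⟩ := hcover.exists_affine (π x)
  have hxU : x ∈ π ⁻¹ᵁ U := hxU
  have hηW : η ∈ π ⁻¹ᵁ U := hηx.mem_open (π ⁻¹ᵁ U).isOpen hxU
  have hηV : π η ∈ V := mem_of_dense_of_generic hY
    (generic_of_specializes_of_ne hy (hηx.map π.continuous) (hcover.ne_of_generic hX hy hη)) hV
  refine Subtype.ext (eq_one_of_mem_inertia_of_isIso hiso hηV ?_)
  rw [mem_inertia_iff hW hηW]
  intro b
  rw [← stalkSpecializes_germHom hηx hxU hηW, ← stalkSpecializes_germHom hηx hxU hηW,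
    ← inertiaAct_germHom hxU g, hid]

lemma exists_generator_inertia : ∃ i : inertia ρ x, orderOf i = ramIndex ρ x ∧
    (∀ g, g ∈ Subgroup.zpowers i) ∧
    IsPrimitiveRoot (cotangentCharacter ρ x i : X.residueField x) (ramIndex ρ x) := by
  have hinj := cotangentCharacter_injective hcover hX hY htorsor hy hn
  have hcyc : IsCyclic (inertia ρ x) := isCyclic_of_injective_ringHom
    ((Units.coeHom (X.residueField x)).comp (cotangentCharacter ρ x))
    (Units.val_injective.comp hinj)
  obtain ⟨i, hi⟩ := hcyc.exists_generator
  have ho : orderOf i = ramIndex ρ x := orderOf_eq_card_of_forall_mem_zpowers hi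
  refine ⟨i, ho, hi, ?_⟩
  rw [← ho, ← orderOf_injective _ hinj, ← orderOf_units]
  exact IsPrimitiveRoot.orderOf _

lemma isUnit_ramIndex : IsUnit ((ramIndex ρ x : ℕ) : X.presheaf.stalk x) := by
  obtain ⟨i, hi, -⟩ := exists_generator_inertia hcover hX hY htorsor hy hn
  have : ramIndex ρ x ∣ Monoid.exponent G := by
    rw [← hi, ← Subgroup.orderOf_coe]
    exact Monoid.order_dvd_exponent _
  exact isUnit_of_dvd_unit (Nat.cast_dvd_cast this) hn

lemma modEq_of_cotangentCharacter_pow_eq {a b : ℕ}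
    (h : ∀ g, (cotangentCharacter ρ x g : X.residueField x) ^ a =
      (cotangentCharacter ρ x g : X.residueField x) ^ b) : a ≡ b [MOD ramIndex ρ x] := by
  obtain ⟨i, hi, -, hp⟩ := exists_generator_inertia hcover hX hY htorsor hy hn
  rw [hp.eq_orderOf]
  have : cotangentCharacter ρ x i ^ a = cotangentCharacter ρ x i ^ b := Units.ext (by simpa using h i)
  rw [orderOf_units]
  exact pow_eq_pow_iff_modEq.mp this

omit hcover hX hY htorsor hy hn in
lemma ramIndex_pos : 0 < ramIndex ρ x := Nat.card_pos

variable {R : Type u} [CommRing R] (f : Y ⟶ Spec (CommRingCat.of R)) (φ : G →* Rˣ)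

/-- The set in the definition is nonempty, so `sInf` does not take its default value: `φ` sends a
generator of `I_x` to an `e_x`-th root of unity of `κ(x)`, which is a power of the primitive root
given by `ψ_x`. -/
lemma cotangentExponent_spec : cotangentExponent ρ f φ x < ramIndex ρ x ∧ ∀ g : inertia ρ x,
    X.residue x (scalar (π ≫ f) x (φ g.1 : R)) =
      (cotangentCharacter ρ x g : X.residueField x) ^ cotangentExponent ρ f φ x := by
  obtain ⟨i, hi, hgen, hp⟩ := exists_generator_inertia hcover hX hY htorsor hy hn
  have he := ramIndex_pos (ρ := ρ) (x := x)
  have : NeZero (ramIndex ρ x) := ⟨he.ne'⟩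
  refine Nat.sInf_mem (s := {k | k < ramIndex ρ x ∧ ∀ g : inertia ρ x,
    X.residue x (scalar (π ≫ f) x (φ g.1 : R)) =
      (cotangentCharacter ρ x g : X.residueField x) ^ k}) ?_
  let χ : inertia ρ x →* (X.residueField x)ˣ :=
    (Units.map ((X.residue x).hom.comp (scalar (π ≫ f) x) : R →* X.residueField x)).comp
      (φ.comp (inertia ρ x).subtype)
  have hχ : (χ i : X.residueField x) ^ ramIndex ρ x = 1 := by
    rw [← hi, ← Units.val_pow_eq_pow_val, ← map_pow, pow_orderOf_eq_one, map_one, Units.val_one]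
  obtain ⟨k, hk, hk'⟩ := hp.eq_pow_of_pow_eq_one hχ
  refine ⟨k, hk, fun g => ?_⟩
  obtain ⟨m, rfl⟩ := hgen g
  have h1 : χ i = cotangentCharacter ρ x i ^ k := Units.ext (by simpa using hk'.symm)
  have h2 : χ (i ^ m) = cotangentCharacter ρ x (i ^ m) ^ k := by
    rw [map_zpow, map_zpow, h1, ← zpow_natCast, ← zpow_natCast, ← zpow_mul, ← zpow_mul, mul_comm]
  exact (congrArg Units.val h2).trans (Units.val_pow_eq_pow_val _ _)

lemma cotangentExponent_modEq {k : ℕ} (h : ∀ g : inertia ρ x,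
    X.residue x (scalar (π ≫ f) x (φ g.1 : R)) =
      (cotangentCharacter ρ x g : X.residueField x) ^ k) :
    cotangentExponent ρ f φ x ≡ k [MOD ramIndex ρ x] :=
  modEq_of_cotangentCharacter_pow_eq hcover hX hY htorsor hy hn fun g => by
    rw [← h, (cotangentExponent_spec hcover hX hY htorsor hy hn f φ).2]

lemma cotangentExponent_mul (φ' : G →* Rˣ) : cotangentExponent ρ f (φ * φ') x ≡
    cotangentExponent ρ f φ x + cotangentExponent ρ f φ' x [MOD ramIndex ρ x] := by
  refine cotangentExponent_modEq hcover hX hY htorsor hy hn f _ fun g => ?_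
  rw [pow_add, ← (cotangentExponent_spec hcover hX hY htorsor hy hn f φ).2,
    ← (cotangentExponent_spec hcover hX hY htorsor hy hn f φ').2]
  simp

lemma cotangentExponent_one : cotangentExponent ρ f (1 : G →* Rˣ) x ≡ 0 [MOD ramIndex ρ x] := by
  refine cotangentExponent_modEq hcover hX hY htorsor hy hn f _ fun g => ?_
  simp

end Tame

/-! ### Compatibility of the scalars from `R`. -/

section Scalar

variable {R : Type u} [CommRing R] {X Y : Scheme.{u}} {π : X ⟶ Y}

/-- The structural ring homomorphism `R → Γ(Y, U)` of a scheme over `Spec R`. -/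
def sectionScalar (f : Y ⟶ Spec (CommRingCat.of R)) (U : Y.Opens) : R →+* Γ(Y, U) :=
  ((Scheme.ΓSpecIso (CommRingCat.of R)).inv ≫ f.appTop ≫
    Y.presheaf.map (homOfLE (le_top (a := U))).op).hom

lemma germHom_sectionScalar (f : Y ⟶ Spec (CommRingCat.of R)) {U : Y.Opens} {y : Y} (hy : y ∈ U)
    (r : R) : germHom U y hy (sectionScalar f U r) = scalar f y r := by
  have : (Scheme.ΓSpecIso (CommRingCat.of R)).inv ≫ f.appTop ≫
      Y.presheaf.map (homOfLE (le_top (a := U))).op ≫ Y.presheaf.germ U y hy =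
      (Scheme.ΓSpecIso (CommRingCat.of R)).inv ≫ f.appTop ≫ Y.presheaf.germ ⊤ y trivial := by
    rw [Y.presheaf.germ_res]
  exact congrArg (fun q => q.hom r) this

lemma pullStalk_scalar (f : Y ⟶ Spec (CommRingCat.of R)) {x : X} {y : Y} (h : π x ⤳ y) (r : R) :
    pullStalk π h (scalar f y r) = scalar (π ≫ f) x r := by
  have hy : y ∈ (⊤ : Y.Opens) := trivial
  have hx : x ∈ π ⁻¹ᵁ ⊤ := trivial
  have h1 := pullStalk_germHom (π := π) ⊤ h hy hx (sectionScalar f ⊤ r)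
  rw [germHom_sectionScalar] at h1
  rw [h1]
  have : Y.presheaf.map (homOfLE (le_top (a := (⊤ : Y.Opens)))).op = 𝟙 _ := Y.presheaf.map_id _
  rw [sectionScalar, this, Category.comp_id, scalar, Scheme.Hom.comp_appTop]
  rfl

end Scalar

/-! ### Eigensections by twisted traces, and the ramification index. -/

section TwistedTrace

variable {G : Type v} [Group G] [Finite G] {X Y : Scheme.{u}} {π : X ⟶ Y}
  {ρ : G →* Aut (Over.mk π)} (hcover : IsGCover ρ) {x : X}
include hcover

/-- By incomparability, the prime of a conjugate `g x ≠ x` is not contained in that of `x`; a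
product of elements witnessing this works for all `g` at once. -/
lemma exists_vanishing_section {U : Y.Opens} (hU : IsAffineOpen U) (hx : x ∈ π ⁻¹ᵁ U) :
    ∃ h : Γ(X, π ⁻¹ᵁ U), IsUnit (germHom _ x hx h) ∧
      ∀ g, act ρ g x ≠ x → sectionAct ρ U g h ∈ pointIdeal (π ⁻¹ᵁ U) x hx := by
  classical
  have : Fintype G := Fintype.ofFinite G
  have h1 : ∀ g, act ρ g x ≠ x → ∃ h : Γ(X, π ⁻¹ᵁ U), IsUnit (germHom _ x hx h) ∧
      sectionAct ρ U g h ∈ pointIdeal (π ⁻¹ᵁ U) x hx := by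
    intro g hg
    have hnot : ¬ pointIdeal (π ⁻¹ᵁ U) (act ρ g x) (mem_preimage_act ρ hx g) ≤
        pointIdeal (π ⁻¹ᵁ U) x hx := fun hle =>
      hg (hcover.eq_of_specializes
        (specializes_of_pointIdeal_le (hcover.isAffineOpen hU) hle) (π_act ρ g x))
    obtain ⟨h, hh, hh'⟩ := Set.not_subset.mp hnot
    exact ⟨h, notMem_pointIdeal.mp hh', (mem_pointIdeal_act ρ hx g h).mp hh⟩
  choose! h hu hm using h1
  refine ⟨∏ g with act ρ g x ≠ x, h g, ?_, fun g hg => ?_⟩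
  · rw [map_prod, IsUnit.prod_iff]
    exact fun g hg => hu g (Finset.mem_filter.mp hg).2
  · rw [map_prod]
    exact Ideal.prod_mem _ (Finset.mem_filter.mpr ⟨Finset.mem_univ g, hg⟩) (hm g hg)

/-- A section with a simple zero at `x`, which vanishes at all conjugates of `x`. -/
lemma exists_section_hasOrder_one [IsDomain (X.presheaf.stalk x)]
    [IsDiscreteValuationRing (X.presheaf.stalk x)] {U : Y.Opens} (hU : IsAffineOpen U)
    (hx : x ∈ π ⁻¹ᵁ U) :
    ∃ z : Γ(X, π ⁻¹ᵁ U), HasOrder (germHom _ x hx z) 1 ∧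
      ∀ g, sectionAct ρ U g z ∈ pointIdeal (π ⁻¹ᵁ U) x hx := by
  obtain ⟨h, hh, hh'⟩ := exists_vanishing_section hcover hU hx
  obtain ⟨t, ht⟩ := exists_hasOrder_one (O := X.presheaf.stalk x)
  obtain ⟨d, b, hd, hdb⟩ := exists_germHom_mul (hcover.isAffineOpen hU) x hx t
  have hb : HasOrder (germHom _ x hx b) 1 := by rw [← hdb]; exact ht.mul_unit hd
  refine ⟨h * b, by rw [map_mul]; exact hb.mul_unit hh, fun g => ?_⟩
  rw [map_mul]
  by_cases hg : act ρ g x = x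
  · refine Ideal.mul_mem_left _ _ ?_
    rw [← mem_pointIdeal_act ρ hx g]
    have hbm : b ∈ pointIdeal (π ⁻¹ᵁ U) x hx := by
      rw [mem_pointIdeal]; simpa using hb.mem
    convert hbm
  · exact Ideal.mul_mem_right _ _ (hh' g hg)

variable (hX : IsRegularScheme X) (hY : IsRegularScheme Y) (htorsor : IsGenericallyTorsor ρ)
  (hy : ringKrullDim (Y.presheaf.stalk (π x)) = 1)
  (hn : IsUnit ((Monoid.exponent G : ℕ) : X.presheaf.stalk x))
  {R : Type u} [CommRing R] (f : Y ⟶ Spec (CommRingCat.of R)) (φ : G →* Rˣ)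
include hX hY htorsor hy hn

/-- An eigenvector of `G` with a prescribed order at `x`, congruent to `n(φ, x)` modulo `e_x`. -/
lemma exists_eigensection {U : Y.Opens} (hU : IsAffineOpen U) (hx : x ∈ π ⁻¹ᵁ U) {ν : ℕ}
    (hν : ∀ g : inertia ρ x, X.residue x (scalar (π ≫ f) x (φ g.1 : R)) =
      (cotangentCharacter ρ x g : X.residueField x) ^ ν) :
    ∃ u : Γ(X, π ⁻¹ᵁ U), (∀ g, sectionAct ρ U g u =
      (π.app U).hom (sectionScalar f U (φ g : R)) * u) ∧ HasOrder (germHom _ x hx u) ν := by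
  classical
  have := hcover.isDomain_stalk hX hy
  have := hcover.isDiscreteValuationRing_stalk hX hy
  have : Fintype G := Fintype.ofFinite G
  obtain ⟨z₁, hz₁, hz₁'⟩ := exists_section_hasOrder_one hcover hU hx
  -- All conjugates of `z₁` vanish at `x`, so each `g z` is still a multiple `l g * z` in the local
  -- ring.
  let z := z₁ ^ ν
  have hz : HasOrder (germHom _ x hx z) ν := by
    have := hz₁.pow ν
    rwa [one_mul, ← map_pow] at this
  have hl : ∀ g, ∃ l, germHom _ x hx (sectionAct ρ U g z) = l * germHom _ x hx z := by
    intro g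
    have : germHom _ x hx (sectionAct ρ U g z) ∈ maximalIdeal (X.presheaf.stalk x) ^ ν := by
      rw [map_pow, map_pow]
      exact Ideal.pow_mem_pow (mem_pointIdeal.mp (hz₁' g)) ν
    obtain ⟨l, hl⟩ := hz.dvd this
    exact ⟨l, by rw [hl, mul_comm]⟩
  choose l hl using hl
  let s : R →+* Γ(X, π ⁻¹ᵁ U) := (π.app U).hom.comp (sectionScalar f U)
  have hs (r : R) : germHom _ x hx (s r) = scalar (π ≫ f) x r := by
    have hx' : π x ∈ U := hx
    change germHom _ x hx ((π.app U).hom (sectionScalar f U r)) = _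
    rw [← pullStalk_germHom U (specializes_refl (π x)) hx' hx, germHom_sectionScalar,
      pullStalk_scalar]
  let γ (g : G) : Γ(X, π ⁻¹ᵁ U) →+* X.presheaf.stalk x := (germHom _ x hx).comp (sectionAct ρ U g)
  have hγ1 (b) : γ 1 b = germHom _ x hx b := by
    change germHom _ x hx (sectionAct ρ U 1 b) = _
    rw [sectionAct_one]
  obtain ⟨b, hb⟩ := exists_isUnit_sum_of_sum_ne_zero γ
    (fun g => scalar (π ≫ f) x ((φ g)⁻¹ : Rˣ) * l g) 1 (by
      -- The characters `b ↦ (g b)(x)` that coincide with evaluation at `x` are those with `g` in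
      -- `I_x`.
      have hmem : ∀ g, (∀ b, residue _ (γ g b) = residue _ (γ 1 b)) ↔ g ∈ inertia ρ x := by
        intro g
        rw [mem_inertia_iff (hcover.isAffineOpen hU) hx]
        simp only [hγ1]
        rfl
      simp only [hmem]
      -- On inertia `l g ≡ ψ_x(g) ^ ν ≡ φ(g)`, so the twist makes each term `1` and the sum is
      -- `e_x`, a unit.
      have hterm : ∀ g ∈ Finset.univ.filter (fun g => g ∈ inertia ρ x),
          residue _ (scalar (π ≫ f) x ((φ g)⁻¹ : Rˣ) * l g) = 1 := by
        intro g hg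
        have hg := (Finset.mem_filter.mp hg).2
        obtain ⟨l', hl', hl''⟩ := inertiaAct_of_hasOrder hcover ⟨g, hg⟩ hz
        have : l g = l' := mul_right_cancel₀ hz.ne_zero (by
          rw [← hl', inertiaAct_germHom hx, hl])
        have h2 : residue _ (l g) = residue _ (scalar (π ≫ f) x (φ g : R)) := by
          rw [this]
          exact hl''.trans (hν ⟨g, hg⟩).symm
        rw [map_mul, h2, ← map_mul, ← map_mul, ← Units.val_mul, inv_mul_cancel, Units.val_one,
          map_one, map_one]
      rw [Finset.sum_congr rfl hterm, Finset.sum_const, nsmul_one]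
      have hcard : (Finset.univ.filter (fun g => g ∈ inertia ρ x)).card = ramIndex ρ x := by
        rw [ramIndex, Nat.card_eq_fintype_card, Fintype.card_subtype]
      rw [hcard, ← map_natCast (residue (X.presheaf.stalk x)), residue_ne_zero_iff_isUnit]
      exact isUnit_ramIndex hcover hX hY htorsor hy hn)
  refine ⟨∑ g, s ((φ g)⁻¹ : Rˣ) * sectionAct ρ U g (z * b), fun h => ?_, ?_⟩
  · rw [map_sum, Finset.mul_sum]
    refine Eq.trans ?_ (Equiv.sum_comp (Equiv.mulRight h)
      fun g => s (φ h) * (s ((φ g)⁻¹ : Rˣ) * sectionAct ρ U g (z * b)))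
    refine Finset.sum_congr rfl fun g _ => ?_
    change sectionAct ρ U h (s ((φ g)⁻¹ : Rˣ) * sectionAct ρ U g (z * b)) =
      s (φ h) * (s ((φ (g * h))⁻¹ : Rˣ) * sectionAct ρ U (g * h) (z * b))
    have h1 : sectionAct ρ U h (s ((φ g)⁻¹ : Rˣ)) = s ((φ g)⁻¹ : Rˣ) := sectionAct_app ρ U h _
    rw [map_mul, h1, ← mul_assoc, ← map_mul, ← Units.val_mul, sectionAct_mul]
    congr 4
    rw [map_mul, mul_inv_rev, mul_inv_cancel_left]
  · have : germHom _ x hx (∑ g, s ((φ g)⁻¹ : Rˣ) * sectionAct ρ U g (z * b)) =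
        (∑ g, (scalar (π ≫ f) x ((φ g)⁻¹ : Rˣ) * l g) * γ g b) * germHom _ x hx z := by
      rw [map_sum, Finset.sum_mul]
      refine Finset.sum_congr rfl fun g _ => ?_
      rw [map_mul, hs, map_mul, map_mul, hl]
      change _ * (_ * γ g b) = _
      ring
    rw [this]
    exact hz.mul_unit hb

omit hcover hX hY htorsor hy hn [Finite G] in
lemma inertiaAct_pullStalk (g : inertia ρ x) {y : Y} (h : π x ⤳ y) (a : Y.presheaf.stalk y) :
    inertiaAct ρ x g (pullStalk π h a) = pullStalk π h a := by
  have h' : π (act ρ g.1 x) ⤳ y := by rw [π_act]; exact h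
  have h1 := stalkSpecializes_pullStalk π (specializes_of_eq (inertia_fix ρ g.2)) h' h a
  refine Eq.trans ?_ (stalkEquiv_pullStalk ρ g.1 x h' h a)
  rw [← h1]
  rfl

include f in
/-- The ramification index of `𝒪_{Y, π x} → 𝒪_{X,x}` is the order of the inertia group. -/
lemma hasOrder_pullStalk [IsDomain (Y.presheaf.stalk (π x))]
    [IsDiscreteValuationRing (Y.presheaf.stalk (π x))] {ϖ : Y.presheaf.stalk (π x)}
    (hϖ : HasOrder ϖ 1) : HasOrder (pullStalk π (specializes_refl (π x)) ϖ) (ramIndex ρ x) := by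
  have := hcover.isDomain_stalk hX hy
  have := hcover.isDiscreteValuationRing_stalk hX hy
  obtain ⟨U, hU, hW, hx⟩ := hcover.exists_affine (π x)
  have hx' : x ∈ π ⁻¹ᵁ U := hx
  have hpos := ramIndex_pos (ρ := ρ) (x := x)
  -- For the trivial character the order `e_x` is admissible, as `ψ_x ^ e_x = 1`. The resulting
  -- section is invariant and descends to `Y`.
  obtain ⟨u, hu, hux⟩ := exists_eigensection hcover hX hY htorsor hy hn f (1 : G →* Rˣ) hU hx'
    (ν := ramIndex ρ x) (fun g => by
      have : g ^ ramIndex ρ x = 1 := pow_card_eq_one'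
      rw [← Units.val_pow_eq_pow_val, ← map_pow, this, map_one]
      simp)
  obtain ⟨a, rfl⟩ := hcover.exists_app_eq (b := u) fun g => by rw [hu]; simp
  rw [← pullStalk_germHom U (specializes_refl (π x)) hx hx'] at hux
  set p := pullStalk π (specializes_refl (π x))
  have ha : germHom U (π x) hx a ≠ 0 := fun h => hux.ne_zero (by rw [h, map_zero])
  obtain ⟨k, hk⟩ := exists_hasOrder ha
  obtain ⟨w, hw, hwk⟩ := (show HasOrder (ϖ ^ k) k by simpa using hϖ.pow k).exists_unit hk
  rw [hwk, map_mul, map_pow] at hux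
  have hp0 : p ϖ ≠ 0 := by
    intro h0
    rcases Nat.eq_zero_or_pos k with rfl | hk
    · rw [pow_zero, mul_one] at hux
      exact hpos.ne' (hux.unique (hasOrder_zero_iff.mpr (hw.map p)))
    · rw [h0, zero_pow hk.ne', mul_zero] at hux
      exact hux.ne_zero rfl
  obtain ⟨e, he⟩ := exists_hasOrder hp0
  -- Thus the order `e` of `ϖ` divides `e_x`. Conversely inertia fixes `ϖ`, so `ψ_x ^ e = 1` and
  -- `e_x` divides `e`.
  have h1 : ramIndex ρ x = e * k := hux.unique ((he.pow k).mul_unit (hw.map p))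
  have h2 : e ≡ 0 [MOD ramIndex ρ x] := by
    refine modEq_of_cotangentCharacter_pow_eq hcover hX hY htorsor hy hn fun g => ?_
    obtain ⟨l, hl, hl'⟩ := inertiaAct_of_hasOrder hcover g he
    have : l = 1 := mul_right_cancel₀ hp0 (by rw [← hl, inertiaAct_pullStalk, one_mul])
    rw [← hl', this, map_one, pow_zero]
  have h3 : ramIndex ρ x = e :=
    Nat.dvd_antisymm ((Nat.modEq_zero_iff_dvd).mp h2) ⟨k, h1⟩
  rwa [h3]

end TwistedTrace

/-! ### Meromorphic stalks and descent of invariants. -/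

section Mero

variable {G : Type v} [Group G] {X Y : Scheme.{u}} {π : X ⟶ Y} {ρ : G →* Aut (Over.mk π)}

lemma GenericOver.mem_preimage {U : Y.Opens} {y : Y} (hy : y ∈ U) (η : GenericOver π y) :
    η.1 ∈ π ⁻¹ᵁ U := η.2.2.mem_open U.isOpen hy

/-- The germ at `y` of a section of `π_* 𝒪_X`, as an element of the stalk of `π_* 𝒦_X`. -/
def sectionMero {U : Y.Opens} {y : Y} (hy : y ∈ U) : Γ(X, π ⁻¹ᵁ U) →+* MeroStalk π y :=
  RingHom.pi fun η : GenericOver π y => germHom (π ⁻¹ᵁ U) η.1 (η.mem_preimage hy)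

lemma sectionMero_apply {U : Y.Opens} {y : Y} (hy : y ∈ U) (b : Γ(X, π ⁻¹ᵁ U))
    (η : GenericOver π y) :
    sectionMero hy b η = germHom (π ⁻¹ᵁ U) η.1 (η.mem_preimage hy) b := rfl

lemma mero_mul_apply {y : Y} (s t : MeroStalk π y) (η : GenericOver π y) :
    (s * t) η = s η * t η := rfl

lemma pullMero_sectionMero {U : Y.Opens} {y : Y} (hy : y ∈ U) (g : G) (b : Γ(X, π ⁻¹ᵁ U)) :
    pullMero ρ y g (sectionMero hy b) = sectionMero hy (sectionAct ρ U g b) := by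
  funext η
  exact stalkMap_germHom ρ U g η.1 _ _ b

lemma algebraMap_germHom {U : Y.Opens} {y : Y} (hy : y ∈ U) (a : Γ(Y, U)) :
    algebraMap (Y.presheaf.stalk y) (MeroStalk π y) (germHom U y hy a) =
      sectionMero hy ((π.app U).hom a) := by
  funext η
  exact pullStalk_germHom U η.2.2 hy _ a

lemma eq_zero_of_mem_pointIdeal (hX : IsRegularScheme X) {W : X.Opens} {η : X} (hη : η ∈ W)
    (hgen : ∀ z : X, z ⤳ η → z = η) {b : Γ(X, W)} (hb : b ∈ pointIdeal W η hη) :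
    germHom W η hη b = 0 := by
  by_contra h0
  obtain ⟨c, hc⟩ := (isField_stalk_of_generic hX hgen).mul_inv_cancel h0
  exact notMem_pointIdeal.mpr (IsUnit.of_mul_eq_one _ hc) hb

lemma pointIdeal_mem_minimalPrimes {W : X.Opens} (hW : IsAffineOpen W) {η : X} (hη : η ∈ W)
    (hgen : ∀ z : X, z ⤳ η → z = η) : pointIdeal W η hη ∈ minimalPrimes Γ(X, W) := by
  refine ⟨⟨inferInstance, bot_le⟩, fun p hp hle => ?_⟩
  have := hp.1
  obtain ⟨z, hz, rfl⟩ := exists_pointIdeal_eq hW p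
  obtain rfl := hgen z (specializes_of_pointIdeal_le hW hle)
  exact le_rfl

/-- A section which is invertible at `x` and vanishes at the generic points that do not specialize
to `x`. -/
lemma exists_section_generic (hX : IsRegularScheme X) {W : X.Opens} (hW : IsAffineOpen W) {x : X}
    (hx : x ∈ W) : ∃ h : Γ(X, W), IsUnit (germHom W x hx h) ∧
      ∀ η (hη : η ∈ W), (∀ z : X, z ⤳ η → z = η) → ¬ η ⤳ x → germHom W η hη h = 0 := by
  classical
  have := hX.1
  have hnoeth : IsNoetherianRing Γ(X, W) := IsLocallyNoetherian.component_noetherian ⟨W, hW⟩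
  have hfin := minimalPrimes.finite_of_isNoetherianRing Γ(X, W)
  have h1 : ∀ p : Ideal Γ(X, W), ¬ p ≤ pointIdeal W x hx → ∃ h ∈ p, h ∉ pointIdeal W x hx :=
    fun p hp => Set.not_subset.mp hp
  choose! h hp hq using h1
  refine ⟨∏ p ∈ hfin.toFinset with ¬ p ≤ pointIdeal W x hx, h p, ?_, fun η hη hgen hηx => ?_⟩
  · rw [map_prod, IsUnit.prod_iff]
    exact fun p hp => notMem_pointIdeal.mp (hq p (Finset.mem_filter.mp hp).2)
  · refine eq_zero_of_mem_pointIdeal hX hη hgen ?_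
    have hle : ¬ pointIdeal W η hη ≤ pointIdeal W x hx :=
      fun hle => hηx (specializes_of_pointIdeal_le hW hle)
    exact Ideal.prod_mem _ (Finset.mem_filter.mpr
      ⟨hfin.mem_toFinset.mpr (pointIdeal_mem_minimalPrimes hW hη hgen), hle⟩) (hp _ hle)

variable [Finite G] (hcover : IsGCover ρ) (hX : IsRegularScheme X) {y : Y}
  (hy : ringKrullDim (Y.presheaf.stalk y) = 1)
include hcover hX hy

/-- Each stalk above `y` is a domain embedded in a generic stalk, so `b` vanishes at every point of
the fibre and its annihilator lies in none of their primes. -/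
lemma exists_mul_eq_zero_of_sectionMero_eq_zero {U : Y.Opens} (hU : IsAffineOpen U) (hyU : y ∈ U)
    {b : Γ(X, π ⁻¹ᵁ U)} (hb : sectionMero hyU b = 0) :
    ∃ a : Γ(Y, U), IsUnit (germHom U y hyU a) ∧ (π.app U).hom a * b = 0 := by
  obtain ⟨a, ha, haJ⟩ := hcover.exists_isUnit_mem hU hyU (Ideal.span {b}).annihilator
    (fun x hx => by
      subst hx
      have := hcover.isDomain_stalk hX hy
      have hxW : x ∈ π ⁻¹ᵁ U := hyU
      obtain ⟨η, hηx, hη⟩ := exists_generic_specializes x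
      have h0 : germHom (π ⁻¹ᵁ U) x hxW b = 0 := by
        refine stalkSpecializes_injective (hcover.isAffineOpen hU) hηx hxW ?_
        rw [map_zero]
        exact (stalkSpecializes_germHom hηx hxW (hηx.mem_open (π ⁻¹ᵁ U).isOpen hxW) b).trans
          (congrFun hb ⟨η, hη, hηx.map π.continuous⟩)
      obtain ⟨d, hd, hdb⟩ := exists_mul_eq_zero (hcover.isAffineOpen hU) x hxW h0
      exact ⟨d, Submodule.mem_annihilator_span_singleton _ _ |>.mpr hdb, hd⟩)
  exact ⟨a, ha, Submodule.mem_annihilator_span_singleton _ _ |>.mp haJ⟩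

/-- A `G`-invariant element of the stalk of `π_* 𝒦_X` at `y` which is integral at all points
above `y` comes from `𝒪_{Y,y}`. -/
lemma exists_algebraMap_eq {s : MeroStalk π y} (hs : ∀ g, pullMero ρ y g s = s)
    (hint : ∀ x, π x = y → ∃ b : X.presheaf.stalk x, ∀ (η : GenericOver π y) (h : η.1 ⤳ x),
      s η = X.presheaf.stalkSpecializes h b) :
    ∃ a, algebraMap (Y.presheaf.stalk y) (MeroStalk π y) a = s := by
  classical
  have : Fintype G := Fintype.ofFinite G
  obtain ⟨U, hU, hW, hyU⟩ := hcover.exists_affine y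
  -- The ideal of denominators of `s`; it will contain a section coming from `Y` and invertible at
  -- `y`.
  let J : Ideal Γ(X, π ⁻¹ᵁ U) :=
    { carrier := {b | ∃ c, sectionMero hyU b * s = sectionMero hyU c}
      add_mem' := by
        rintro a b ⟨c, hc⟩ ⟨d, hd⟩
        exact ⟨c + d, by rw [map_add, add_mul, hc, hd, map_add]⟩
      zero_mem' := ⟨0, by rw [map_zero, zero_mul]⟩
      smul_mem' := by
        rintro a b ⟨c, hc⟩
        exact ⟨a * c, by rw [smul_eq_mul, map_mul, mul_assoc, hc, map_mul]⟩ }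
  obtain ⟨a, ha, c, hc⟩ := hcover.exists_isUnit_mem hU hyU J (fun x hx => by
    obtain ⟨q, hq⟩ := hint x hx
    subst hx
    have hxW : x ∈ π ⁻¹ᵁ U := hyU
    obtain ⟨d, b, hd, hdb⟩ := exists_germHom_mul hW x hxW q
    -- Integrality at `x` says nothing at generic points that do not specialize to `x`; the factor
    -- `h` vanishes there.
    obtain ⟨h, hh, hh'⟩ := exists_section_generic hX hW hxW
    refine ⟨h * d, ⟨h * b, ?_⟩, by rw [map_mul]; exact hh.mul hd⟩
    funext η
    rw [mero_mul_apply, sectionMero_apply, sectionMero_apply, map_mul, map_mul, mul_assoc]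
    by_cases hηx : η.1 ⤳ x
    · congr 1
      rw [hq η hηx, ← stalkSpecializes_germHom hηx hxW, ← stalkSpecializes_germHom hηx hxW, ← hdb,
        map_mul]
    · rw [hh' η.1 _ η.2.1 hηx, zero_mul, zero_mul])
  -- The numerator `c` is invariant only in the stalk; a further denominator from `Y` makes it
  -- invariant as a section.
  have hinv (g : G) : sectionMero hyU (sectionAct ρ U g c - c) = 0 := by
    rw [map_sub, ← pullMero_sectionMero, ← hc, map_mul, hs, pullMero_sectionMero, sectionAct_app,
      sub_self]
  choose a' ha' ha'' using fun g =>
    exists_mul_eq_zero_of_sectionMero_eq_zero hcover hX hy hU hyU (hinv g)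
  obtain ⟨t, ht⟩ := hcover.exists_app_eq (b := (π.app U).hom (∏ g, a' g) * c) (fun g => by
    rw [map_mul, sectionAct_app, ← sub_eq_zero, ← mul_sub, ← Finset.prod_erase_mul _ _
      (Finset.mem_univ g), map_mul, mul_assoc, ha'', mul_zero])
  have hA : IsUnit (germHom U y hyU ((∏ g, a' g) * a)) := by
    rw [map_mul, map_prod]
    exact ((IsUnit.prod_iff).mpr fun g _ => ha' g).mul ha
  obtain ⟨w, hw⟩ := hA.exists_left_inv
  refine ⟨w * germHom U y hyU t, ?_⟩
  rw [map_mul, algebraMap_germHom, ht, map_mul, ← hc, ← mul_assoc (sectionMero hyU _), ← map_mul,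
    ← map_mul, ← algebraMap_germHom, ← mul_assoc, ← map_mul, hw, map_one, one_mul]

end Mero

/-! ### Local structure of the cover, uniform along a fibre. -/

section LocalStructure

lemma isUnit_natCast_stalk {R : Type u} [CommRing R] {X : Scheme.{u}}
    (p : X ⟶ Spec (CommRingCat.of R)) {n : ℕ} (hn : IsUnit (n : R)) (x : X) :
    IsUnit (n : X.presheaf.stalk x) := by
  have := hn.map (scalar p x)
  rwa [map_natCast] at this

variable {G : Type v} [Group G] [Finite G] {X Y : Scheme.{u}} {π : X ⟶ Y}
  {ρ : G →* Aut (Over.mk π)} (hcover : IsGCover ρ) (hX : IsRegularScheme X)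
  (hY : IsRegularScheme Y) (htorsor : IsGenericallyTorsor ρ) {y : Y}
  (hy : ringKrullDim (Y.presheaf.stalk y) = 1)
  {R : Type u} [CommRing R] (f : Y ⟶ Spec (CommRingCat.of R)) (φ : G →* Rˣ)
  (hn : IsUnit ((Monoid.exponent G : ℕ) : R))
include hcover hX hY htorsor hy hn

include f in
lemma hasOrder_pullStalk_of_eq [IsDomain (Y.presheaf.stalk y)]
    [IsDiscreteValuationRing (Y.presheaf.stalk y)] {ϖ : Y.presheaf.stalk y} (hϖ : HasOrder ϖ 1)
    {x : X} (hx : π x = y) :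
    HasOrder (pullStalk π (specializes_of_eq hx) ϖ) (ramIndex ρ x) := by
  subst hx
  exact hasOrder_pullStalk hcover hX hY htorsor hy (isUnit_natCast_stalk (π ≫ f) hn x) f hϖ

/-- The local structure of the cover at a point `y` of codimension one. -/
lemma exists_local_structure [IsDomain (Y.presheaf.stalk y)]
    [IsDiscreteValuationRing (Y.presheaf.stalk y)] {ϖ : Y.presheaf.stalk y} (hϖ : HasOrder ϖ 1)
    {U : Y.Opens} (hU : IsAffineOpen U) (hyU : y ∈ U) :
    ∃ e ν : ℕ, ν < e ∧ ∃ u : Γ(X, π ⁻¹ᵁ U),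
      (∀ g, sectionAct ρ U g u = (π.app U).hom (sectionScalar f U (φ g : R)) * u) ∧
      ∀ x, (hx : π x = y) → ramIndex ρ x = e ∧ cotangentExponent ρ f φ x = ν ∧
        HasOrder (pullStalk π (specializes_of_eq hx) ϖ) e ∧
        HasOrder (germHom (π ⁻¹ᵁ U) x (show π x ∈ U by rwa [hx]) u) ν := by
  obtain ⟨x, rfl⟩ := hcover.exists_apply_eq y
  have hnx := isUnit_natCast_stalk (π ≫ f) hn
  have hdom := hcover.isDomain_stalk hX hy
  have hdvr := hcover.isDiscreteValuationRing_stalk hX hy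
  have hxW : x ∈ π ⁻¹ᵁ U := hyU
  obtain ⟨hlt, hν⟩ := cotangentExponent_spec hcover hX hY htorsor hy (hnx x) f φ
  obtain ⟨u, hu, hux⟩ := exists_eigensection hcover hX hY htorsor hy (hnx x) f φ hU hxW hν
  have hϖx := hasOrder_pullStalk_of_eq hcover hX hY htorsor hy f hn hϖ rfl
  refine ⟨_, _, hlt, u, hu, fun x' hx' => ?_⟩
  obtain ⟨g, rfl⟩ := hcover.exists_act_eq hx'.symm
  have hy' : ringKrullDim (Y.presheaf.stalk (π (act ρ g x))) = 1 := by rwa [hx']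
  have hdom' := hcover.isDomain_stalk hX hy'
  have hdvr' := hcover.isDiscreteValuationRing_stalk hX hy'
  have hW' : act ρ g x ∈ π ⁻¹ᵁ U := mem_preimage_act ρ hxW g
  have hscal {z : X} (hz : z ∈ π ⁻¹ᵁ U) (r : R) :
      germHom _ z hz ((π.app U).hom (sectionScalar f U r)) = scalar (π ≫ f) z r := by
    have hz' : π z ∈ U := hz
    rw [← pullStalk_germHom U (specializes_refl (π z)) hz' hz, germHom_sectionScalar,
      pullStalk_scalar]
  have hu' : HasOrder (germHom _ _ hW' u) (cotangentExponent ρ f φ x) := by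
    rw [← hasOrder_map_iff (stalkEquiv ρ g x), stalkEquiv_germHom ρ U g x hW' hxW, hu, map_mul,
      hscal]
    exact hux.mul_unit ((φ g).isUnit.map _)
  have hϖ' : HasOrder (pullStalk π (specializes_of_eq hx') ϖ) (ramIndex ρ x) := by
    rw [← hasOrder_map_iff (stalkEquiv ρ g x), stalkEquiv_pullStalk ρ g x _ (specializes_refl _)]
    exact hϖx
  have he : ramIndex ρ (act ρ g x) = ramIndex ρ x :=
    (hasOrder_pullStalk_of_eq hcover hX hY htorsor hy f hn hϖ hx').unique hϖ'
  refine ⟨he, ?_, hϖ', hu'⟩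
  refine Nat.ModEq.eq_of_lt_of_lt (m := ramIndex ρ x) ?_
    (he ▸ (cotangentExponent_spec hcover hX hY htorsor hy' (hnx _) f φ).1) hlt
  rw [← he]
  refine cotangentExponent_modEq hcover hX hY htorsor hy' (hnx _) f φ fun i => ?_
  -- Inertia at the conjugate point acts on `u` both through `φ` and through the `ν`-th power of its
  -- cotangent character.
  obtain ⟨l, hl, hl'⟩ := inertiaAct_of_hasOrder hcover i hu'
  rw [inertiaAct_germHom hW' i, hu, map_mul, hscal] at hl
  rw [← hl', mul_right_cancel₀ hu'.ne_zero hl]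

end LocalStructure

/-! ### Fractional ideals and their valuations. -/

section Valuation

variable {A L : Type*} [CommRing A] [IsLocalRing A] [CommRing L] [Algebra A L] {ϖ : A}

lemma maximalIdeal_pow_smul_cancel (hϖ : HasOrder ϖ 1) (hp : IsUnit (algebraMap A L ϖ)) {i : ℕ}
    {P Q : Submodule A L} (h : maximalIdeal A ^ i • P = maximalIdeal A ^ i • Q) : P = Q := by
  have hi : maximalIdeal A ^ i = Ideal.span {ϖ ^ i} := by
    have := hϖ.pow i
    rw [one_mul] at this
    exact this.symm
  have hinj : Function.Injective (fun z : L => ϖ ^ i • z) := fun z z' hz => by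
    simp only [Algebra.smul_def, map_pow] at hz
    exact (hp.pow i).mul_left_cancel hz
  have key : ∀ P Q : Submodule A L,
      maximalIdeal A ^ i • P ≤ maximalIdeal A ^ i • Q → P ≤ Q := by
    intro P Q h z hz
    rw [hi, Submodule.ideal_span_singleton_smul, Submodule.ideal_span_singleton_smul] at h
    obtain ⟨q, hq, hqz⟩ := (Submodule.mem_smul_pointwise_iff_exists _ _ _).mp
      (h (Submodule.smul_mem_pointwise_smul z (ϖ ^ i) P hz))
    rwa [← hinj hqz]
  exact le_antisymm (key P Q h.le) (key Q P h.ge)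

lemma maximalIdeal_pow_smul_one_inj [IsDomain A] [IsDiscreteValuationRing A]
    (hinj : Function.Injective (algebraMap A L)) {i j : ℕ}
    (h : maximalIdeal A ^ i • (1 : Submodule A L) = maximalIdeal A ^ j • 1) : i = j := by
  obtain ⟨ϖ, hϖ⟩ := exists_hasOrder_one (O := A)
  have key : ∀ i j : ℕ,
      maximalIdeal A ^ i • (1 : Submodule A L) ≤ maximalIdeal A ^ j • 1 → j ≤ i := by
    intro i j h
    have hi : HasOrder (ϖ ^ i) i := by simpa using hϖ.pow i
    have hj : HasOrder (ϖ ^ j) j := by simpa using hϖ.pow j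
    rw [← hi, ← hj, Submodule.ideal_span_singleton_smul, Submodule.ideal_span_singleton_smul] at h
    obtain ⟨q, hq, hqz⟩ := (Submodule.mem_smul_pointwise_iff_exists _ _ _).mp
      (h (Submodule.smul_mem_pointwise_smul 1 (ϖ ^ i) 1 (Submodule.mem_one.mpr ⟨1, map_one _⟩)))
    obtain ⟨c, rfl⟩ := Submodule.mem_one.mp hq
    rw [Algebra.smul_def, Algebra.smul_def, mul_one, ← map_mul] at hqz
    rw [← hi.mem_iff, ← hinj hqz]
    exact Ideal.mul_mem_right _ _ hj.mem
  exact le_antisymm (key j i h.ge) (key i j h.le)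

lemma smul_span_singleton_eq (v : L) {α : A} {i k : ℕ} (hϖ : HasOrder ϖ 1) (hα : HasOrder α k)
    (hv : ϖ ^ i • v = algebraMap A L α) :
    maximalIdeal A ^ i • Submodule.span A {v} = maximalIdeal A ^ k • (1 : Submodule A L) := by
  have hi : HasOrder (ϖ ^ i) i := by simpa using hϖ.pow i
  rw [← hi, ← hα, Submodule.one_eq_span, Submodule.ideal_span_singleton_smul,
    Submodule.ideal_span_singleton_smul, Submodule.smul_span, Submodule.smul_span,
    Set.smul_set_singleton, Set.smul_set_singleton, hv, Algebra.algebraMap_eq_smul_one]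

end Valuation

section MeroValuation

variable {X Y : Scheme.{u}} {π : X ⟶ Y} {y : Y}

/-- Uniqueness of the exponent: multiply each of the two defining equations by the denominator of
the other and compare powers of `𝔪_y`. -/
lemma valuation_eq [IsDomain (Y.presheaf.stalk y)] [IsDiscreteValuationRing (Y.presheaf.stalk y)]
    (hinj : Function.Injective (algebraMap (Y.presheaf.stalk y) (MeroStalk π y)))
    {N : Submodule (Y.presheaf.stalk y) (MeroStalk π y)} {m : ℤ} (h : HasValuation π y N m) :
    valuation π y N = m := by
  have hex : ∃ m, HasValuation π y N m := ⟨m, h⟩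
  rw [valuation, dif_pos hex]
  have h' := hex.choose_spec
  set l := hex.choose
  unfold HasValuation at h h'
  have e1 := congrArg (maximalIdeal (Y.presheaf.stalk y) ^ (-l).toNat • ·) h
  have e2 := congrArg (maximalIdeal (Y.presheaf.stalk y) ^ (-m).toNat • ·) h'
  simp only [← mul_smul, ← pow_add] at e1 e2
  rw [add_comm] at e2
  have := maximalIdeal_pow_smul_one_inj hinj (e1.symm.trans e2)
  omega

lemma hasValuation_span_singleton {ϖ : Y.presheaf.stalk y} (hϖ : HasOrder ϖ 1)
    (hp : IsUnit (algebraMap (Y.presheaf.stalk y) (MeroStalk π y) ϖ)) {v : MeroStalk π y}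
    {α : Y.presheaf.stalk y} {i k : ℕ} (hα : HasOrder α k) (hv : ϖ ^ i • v = algebraMap _ _ α) :
    HasValuation π y (Submodule.span _ {v}) ((k : ℤ) - i) := by
  refine maximalIdeal_pow_smul_cancel hϖ hp (i := i) ?_
  rw [← mul_smul, mul_comm, mul_smul, smul_span_singleton_eq v hϖ hα hv, ← mul_smul, ← mul_smul,
    ← pow_add, ← pow_add]
  congr 2
  omega

end MeroValuation

/-! ### A generator of the resolvent stalk. -/

section Resolvent

variable {G : Type v} [Group G] [Finite G] {X Y : Scheme.{u}} {π : X ⟶ Y}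
  {ρ : G →* Aut (Over.mk π)} (hcover : IsGCover ρ) (hX : IsRegularScheme X) {y : Y}
  (hy : ringKrullDim (Y.presheaf.stalk y) = 1)
include hcover hX hy

/-- An element of the stalk of `π_* 𝒦_X` given by nonzero germs at the points above `y` is
invertible. -/
lemma isUnit_mero {s : MeroStalk π y} (hs : ∀ x, π x = y → ∃ b : X.presheaf.stalk x, b ≠ 0 ∧
    ∀ (η : GenericOver π y) (h : η.1 ⤳ x), s η = X.presheaf.stalkSpecializes h b) : IsUnit s := by
  have h (η : GenericOver π y) : ∃ c, s η * c = 1 := by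
    obtain ⟨x, hηx, rfl⟩ := hcover.specializingMap η.2.2
    obtain ⟨b, hb, hsb⟩ := hs x rfl
    have := hcover.isDomain_stalk hX hy
    obtain ⟨U, hU, hW, hxU⟩ := hcover.exists_affine (π x)
    have hxW : x ∈ π ⁻¹ᵁ U := hxU
    refine (isField_stalk_of_generic hX η.2.1).mul_inv_cancel ?_
    rw [hsb η hηx]
    intro h0
    exact hb (stalkSpecializes_injective hW hηx hxW (h0.trans (map_zero _).symm))
  choose c hc using h
  exact IsUnit.of_mul_eq_one (c : MeroStalk π y) (funext hc)

variable {R : Type u} [CommRing R] (f : Y ⟶ Spec (CommRingCat.of R)) (φ : G →* Rˣ)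

/-- At each point above `y`, `w = ϖ ^ (-j) u` has order `ν - e j ≥ -d`, so it is a section of
`𝒪_X(D)`. Any other element of the stalk is `c w` with `c` invariant of order greater than `-e`.
Then `ϖ c` is integral and vanishes above `y`, so it comes from `𝔪_y`, and `c` comes from `𝒪_{Y,y}`.
-/
lemma resolventStalk_eq_span [IsDomain (Y.presheaf.stalk y)]
    [IsDiscreteValuationRing (Y.presheaf.stalk y)] {ϖ : Y.presheaf.stalk y} (hϖ : HasOrder ϖ 1)
    {e ν d j : ℕ} (hj : e * j ≤ ν + d) (hj' : ν + d < e * (j + 1))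
    {u w : MeroStalk π y} (hu : ∀ g, pullMero ρ y g u = scalar f y (φ g : R) • u)
    (hux : ∀ x (hx : π x = y), HasOrder (pullStalk π (specializes_of_eq hx) ϖ) e ∧
      ∃ b : X.presheaf.stalk x, HasOrder b ν ∧
        ∀ (η : GenericOver π y) (h : η.1 ⤳ x), u η = X.presheaf.stalkSpecializes h b)
    (hp : IsUnit (algebraMap (Y.presheaf.stalk y) (MeroStalk π y) ϖ))
    (hw : ϖ ^ j • w = u) (hwu : IsUnit w) {D : Divisor X}
    (hD : ∀ x : CodimOne X, π x.1 = y → D x = d) :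
    resolventStalk ρ f D φ y = Submodule.span _ {w} := by
  set p := algebraMap (Y.presheaf.stalk y) (MeroStalk π y) ϖ with hpdef
  have hpη {x : X} (hx : π x = y) (η : GenericOver π y) (h : η.1 ⤳ x) :
      p η = X.presheaf.stalkSpecializes h (pullStalk π (specializes_of_eq hx) ϖ) :=
    (stalkSpecializes_pullStalk π h η.2.2 _ ϖ).symm
  have hwη (η : GenericOver π y) : p η ^ j * w η = u η := by
    have := congrFun hw η
    rw [Algebra.smul_def, map_pow, mero_mul_apply] at this
    exact this
  have hgw (g : G) : pullMero ρ y g w = scalar f y (φ g : R) • w := by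
    refine (hp.pow j).mul_left_cancel ?_
    rw [← map_pow, ← Algebra.smul_def, ← Algebra.smul_def, smul_comm (ϖ ^ j), hw, ← hu, ← hw,
      Algebra.smul_def (ϖ ^ j) w, map_mul, pullMero_algebraMap, Algebra.smul_def]
  have hunit {η : GenericOver π y} {s : MeroStalk π y} (hs : IsUnit s) : IsUnit (s η) :=
    hs.map (Pi.evalRingHom (fun η : GenericOver π y => X.presheaf.stalk η.1) η)
  apply le_antisymm
  · rintro s ⟨hs, hs'⟩
    obtain ⟨c, hc⟩ : ∃ c, c * w = s := by
      obtain ⟨w', hw'⟩ := hwu.exists_left_inv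
      exact ⟨s * w', by rw [mul_assoc, hw', mul_one]⟩
    have hcinv (g : G) : pullMero ρ y g c = c := by
      have h1 : pullMero ρ y g (c * w) = scalar f y (φ g : R) • (c * w) := by rw [hc]; exact hs' g
      have h2 : IsUnit (pullMero ρ y g w) := hwu.map _
      refine h2.mul_right_cancel ?_
      rw [← map_mul, h1, hgw, mul_smul_comm]
    have hint : ∀ x (hx : π x = y), ∃ b ∈ maximalIdeal (X.presheaf.stalk x),
        ∀ (η : GenericOver π y) (h : η.1 ⤳ x), (p * c) η = X.presheaf.stalkSpecializes h b := by
      intro x hx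
      obtain ⟨hϖe, b, hb, hub⟩ := hux x hx
      have hy' : ringKrullDim (Y.presheaf.stalk (π x)) = 1 := by rwa [hx]
      have := hcover.isDomain_stalk hX hy'
      have := hcover.isDiscreteValuationRing_stalk hX hy'
      let x' : CodimOne X := ⟨x, hcover.ringKrullDim_stalk_eq_one hy'⟩
      obtain ⟨t, ht⟩ := exists_hasOrder_one (O := X.presheaf.stalk x)
      have htd : HasOrder (t ^ d) d := by simpa using ht.pow d
      obtain ⟨q, -, hq⟩ := hs x' hx (t ^ d) (by rw [hD x' hx, Int.toNat_natCast]; exact htd.mem)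
      set P := pullStalk π (specializes_of_eq hx) ϖ
      -- The strict inequality `ν + d < e (j + 1)` leaves the spare factor `t`, which puts `ϖ c` in
      -- the maximal ideal.
      obtain ⟨r, hr⟩ := ((hb.mul htd).mul ht).dvd
        (b := P ^ (j + 1)) ((hϖe.pow (j + 1)).mem_iff.mpr hj')
      refine ⟨t * (r * q), Ideal.mul_mem_right _ _ (by simpa using ht.mem), fun η h => ?_⟩
      have hfield := isField_stalk_of_generic hX η.2.1
      have := hfield.isDomain
      obtain ⟨U, hU, hW, hxU⟩ := hcover.exists_affine (π x)
      have hxW : x ∈ π ⁻¹ᵁ U := hxU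
      have hne {z : X.presheaf.stalk x} (hz : z ≠ 0) : X.presheaf.stalkSpecializes h z ≠ 0 :=
        fun h0 => hz (stalkSpecializes_injective hW h hxW (h0.trans (map_zero _).symm))
      have h1 : (p * c) η * X.presheaf.stalkSpecializes h (b * t ^ d) =
          X.presheaf.stalkSpecializes h (P ^ (j + 1) * q) := by
        have h2 : X.presheaf.stalkSpecializes h (t ^ d) * s η =
          X.presheaf.stalkSpecializes h q := hq η h
        have h3 : X.presheaf.stalkSpecializes h (P ^ (j + 1)) = p η ^ (j + 1) := by
          rw [map_pow, ← hpη hx η h]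
        rw [map_mul, map_mul, h3, ← h2, ← hc, ← hub η h, ← hwη, mero_mul_apply, mero_mul_apply]
        ring
      have hne' : X.presheaf.stalkSpecializes h (b * t ^ d) ≠ 0 := hne (hb.mul htd).ne_zero
      refine mul_right_cancel₀ hne' (h1.trans ?_)
      rw [hr, ← map_mul]
      congr 1
      ring
    obtain ⟨a, ha⟩ := exists_algebraMap_eq hcover hX hy (s := p * c)
      (fun g => by rw [map_mul, hcinv, hpdef, pullMero_algebraMap])
      (fun x hx => by obtain ⟨b, -, hb⟩ := hint x hx; exact ⟨b, hb⟩)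
    have ham : a ∈ maximalIdeal (Y.presheaf.stalk y) := by
      obtain ⟨x, hx⟩ := hcover.exists_apply_eq y
      obtain ⟨b, hbm, hb⟩ := hint x hx
      obtain ⟨η, hηx, hη⟩ := exists_generic_specializes x
      have hy' : ringKrullDim (Y.presheaf.stalk (π x)) = 1 := by rwa [hx]
      have := hcover.isDomain_stalk hX hy'
      obtain ⟨U, hU, hW, hxU⟩ := hcover.exists_affine (π x)
      have hxW : x ∈ π ⁻¹ᵁ U := hxU
      have hηy : π η ⤳ y := hx ▸ hηx.map π.continuous
      have h1 := hb ⟨η, hη, hηy⟩ hηx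
      rw [← ha, algebraMap_apply, ← stalkSpecializes_pullStalk π hηx hηy (specializes_of_eq hx)]
        at h1
      have h2 := stalkSpecializes_injective hW hηx hxW h1
      intro hau
      rw [← h2] at hbm
      exact hbm (hau.map _)
    obtain ⟨a', rfl⟩ := hϖ.dvd (by simpa using ham)
    have hca : algebraMap (Y.presheaf.stalk y) (MeroStalk π y) a' = c :=
      hp.mul_left_cancel (by rw [hpdef, ← map_mul, ha])
    refine Submodule.mem_span_singleton.mpr ⟨a', ?_⟩
    rw [Algebra.smul_def, hca, hc]
  · rw [Submodule.span_singleton_le_iff_mem]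
    refine ⟨fun x hx a ha => ?_, hgw⟩
    rw [hD x hx, Int.toNat_natCast] at ha
    obtain ⟨hϖe, b, hb, hub⟩ := hux x.1 hx
    obtain ⟨q, hq⟩ := (hϖe.pow j).dvd (b := b * a) (Ideal.pow_le_pow_right hj (by
      rw [pow_add]; exact Ideal.mul_mem_mul hb.mem ha))
    refine ⟨q, by simp [hD x hx], fun η h => ?_⟩
    refine ((hunit (η := η) hp).pow j).mul_left_cancel ?_
    rw [mul_left_comm, hwη, hub η h, ← map_mul, mul_comm a, hq, map_mul, map_pow, ← hpη hx η h]

end Resolvent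

/-! ### The valuation formula and its two special cases. -/

section Main

variable {G : Type v} [Group G] [Finite G] {X Y : Scheme.{u}} {π : X ⟶ Y}
  {ρ : G →* Aut (Over.mk π)} (hcover : IsGCover ρ) (hX : IsRegularScheme X)
  (hY : IsRegularScheme Y) (htorsor : IsGenericallyTorsor ρ) {x : X}
  (hy : ringKrullDim (Y.presheaf.stalk (π x)) = 1)
  {R : Type u} [CommRing R] (f : Y ⟶ Spec (CommRingCat.of R)) (φ : G →* Rˣ)
  (hn : IsUnit ((Monoid.exponent G : ℕ) : R))
include hcover hX hY htorsor hy hn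

/-- The valuation of the resolvent of `𝒪_X(D)` at `φ`, for a divisor `D` with constant coefficient
`d` at the points above `π x`. -/
lemma resolventValuation_eq {D : Divisor X} {d : ℕ}
    (hD : ∀ x' : CodimOne X, π x'.1 = π x → D x' = d) :
    resolventValuation ρ f D φ (π x) =
      (cotangentExponent ρ f φ x : ℚ) / ramIndex ρ x -
        ((cotangentExponent ρ f φ x + d) / ramIndex ρ x : ℕ) := by
  have := hY.2 (π x)
  have := isDomain_of_regular hy
  have := isDiscreteValuationRing_of_regular hy
  have := hcover.isDomain_stalk hX hy
  have := hcover.isDiscreteValuationRing_stalk hX hy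
  obtain ⟨ϖ, hϖ⟩ := exists_hasOrder_one (O := Y.presheaf.stalk (π x))
  obtain ⟨U, hU, hW, hyU⟩ := hcover.exists_affine (π x)
  obtain ⟨e, ν, hlt, u, hu, hloc⟩ := exists_local_structure hcover hX hY htorsor hy f φ hn hϖ hU hyU
  obtain ⟨he, hν, hϖx, hux⟩ := hloc x rfl
  rw [he, hν]
  have hepos : 0 < e := by omega
  have hnpos : 0 < Monoid.exponent G := Nat.pos_of_ne_zero Monoid.exponent_ne_zero_of_finite
  set n := Monoid.exponent G
  set j := (ν + d) / e
  have hj : e * j ≤ ν + d := Nat.mul_div_le _ _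
  have hj' : ν + d < e * (j + 1) := Nat.lt_mul_div_succ _ hepos
  have hne : ∀ x' (hx' : π x' = π x) {b : X.presheaf.stalk x'} {k : ℕ}, HasOrder b k → b ≠ 0 := by
    intro x' hx' b k hb
    have hy' : ringKrullDim (Y.presheaf.stalk (π x')) = 1 := by rwa [hx']
    have := hcover.isDomain_stalk hX hy'
    have := hcover.isDiscreteValuationRing_stalk hX hy'
    exact hb.ne_zero
  have hp : IsUnit (algebraMap (Y.presheaf.stalk (π x)) (MeroStalk π (π x)) ϖ) :=
    isUnit_mero hcover hX hy fun x' hx' => ⟨_, hne x' hx' (hloc x' hx').2.2.1, fun η h =>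
      (stalkSpecializes_pullStalk π h η.2.2 (specializes_of_eq hx') ϖ).symm⟩
  have huL : IsUnit (sectionMero (π := π) hyU u) :=
    isUnit_mero hcover hX hy fun x' hx' => ⟨_, hne x' hx' (hloc x' hx').2.2.2, fun η h =>
      (stalkSpecializes_germHom h _ _ u).symm⟩
  obtain ⟨q, hq⟩ := hp.exists_right_inv
  have hw : ϖ ^ j • (q ^ j * sectionMero hyU u) = sectionMero hyU u := by
    rw [Algebra.smul_def, map_pow, ← mul_assoc, ← mul_pow, hq, one_pow, one_mul]
  set w : MeroStalk π (π x) := q ^ j * sectionMero hyU u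
  have hwu : IsUnit w := ((IsUnit.of_mul_eq_one_right _ hq).pow j).mul huL
  have heig (g : G) : pullMero ρ (π x) g (sectionMero hyU u) =
      scalar f (π x) (φ g : R) • sectionMero hyU u := by
    rw [pullMero_sectionMero, hu, map_mul, ← algebraMap_germHom, germHom_sectionScalar,
      Algebra.smul_def]
  have hspan := resolventStalk_eq_span hcover hX hy f φ hϖ hj hj' heig
    (fun x' hx' => ⟨(hloc x' hx').2.2.1, _, (hloc x' hx').2.2.2, fun η h =>
      (stalkSpecializes_germHom h _ _ u).symm⟩) hp hw hwu hD
  -- As `φ ^ n = 1`, the power `u ^ n` is invariant and comes from `Y`; comparing orders at `x`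
  -- gives `e k = ν n` for its order `k` at `y`.
  obtain ⟨α, hα⟩ := hcover.exists_app_eq (b := u ^ n) fun g => by
    rw [map_pow, hu, mul_pow, ← map_pow, ← map_pow, ← Units.val_pow_eq_pow_val, ← map_pow,
      Monoid.pow_exponent_eq_one, map_one, Units.val_one, map_one, map_one, one_mul]
  have hxW : x ∈ π ⁻¹ᵁ U := hyU
  have hpα : HasOrder (pullStalk π (specializes_refl (π x)) (germHom U (π x) hyU α)) (ν * n) := by
    rw [pullStalk_germHom U _ hyU hxW, hα, map_pow]
    exact hux.pow n
  have hα0 : germHom U (π x) hyU α ≠ 0 := fun h => hpα.ne_zero (by rw [h, map_zero])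
  obtain ⟨k, hk⟩ := exists_hasOrder hα0
  have hek : e * k = ν * n := by
    obtain ⟨c, hc, hck⟩ := (show HasOrder (ϖ ^ k) k by simpa using hϖ.pow k).exists_unit hk
    rw [hck, map_mul, map_pow] at hpα
    exact ((hϖx.pow k).mul_unit (hc.map _)).unique hpα
  have hval : HasValuation π (π x) (resolventStalk ρ f D φ (π x) ^ n) ((k : ℤ) - (j * n : ℕ)) := by
    rw [hspan, Submodule.span_pow, Set.singleton_pow]
    refine hasValuation_span_singleton hϖ hp hk ?_
    rw [pow_mul, ← smul_pow, hw, ← map_pow, ← hα, algebraMap_germHom]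
  have hinj : Function.Injective (algebraMap (Y.presheaf.stalk (π x)) (MeroStalk π (π x))) := by
    rw [injective_iff_map_eq_zero]
    intro a ha
    by_contra ha0
    obtain ⟨l, hl⟩ := exists_hasOrder ha0
    obtain ⟨c, hc, rfl⟩ := (show HasOrder (ϖ ^ l) l by simpa using hϖ.pow l).exists_unit hl
    have h1 : IsUnit (algebraMap (Y.presheaf.stalk (π x)) (MeroStalk π (π x)) (c * ϖ ^ l)) := by
      rw [map_mul, map_pow]
      exact (hc.map _).mul (hp.pow l)
    rw [ha] at h1
    obtain ⟨η, hηx, hη⟩ := exists_generic_specializes x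
    have h2 := h1.map (Pi.evalRingHom (fun η : GenericOver π (π x) => X.presheaf.stalk η.1)
      ⟨η, hη, hηx.map π.continuous⟩)
    exact not_isUnit_zero h2
  rw [resolventValuation, valuation_eq hinj hval]
  have hn0 : (n : ℚ) ≠ 0 := by exact_mod_cast hnpos.ne'
  have he0 : (e : ℚ) ≠ 0 := by exact_mod_cast hepos.ne'
  have hek' : (e : ℚ) * k = ν * n := by exact_mod_cast hek
  have hkn : (k : ℚ) / n = ν / e := by
    rw [div_eq_div_iff hn0 he0]
    linarith
  change (((k : ℤ) - (j * n : ℕ) : ℤ) : ℚ) / (n : ℚ) = (ν : ℚ) / e - (j : ℚ)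
  rw [Int.cast_sub, Int.cast_natCast, Int.cast_natCast, Nat.cast_mul, sub_div, hkn,
    mul_div_cancel_right₀ _ hn0]

include f in
lemma ramIndex_eq_of_apply_eq {x' : X} (hx' : π x' = π x) : ramIndex ρ x' = ramIndex ρ x := by
  have := hY.2 (π x)
  have := isDomain_of_regular hy
  have := isDiscreteValuationRing_of_regular hy
  obtain ⟨ϖ, hϖ⟩ := exists_hasOrder_one (O := Y.presheaf.stalk (π x))
  obtain ⟨U, hU, hyU⟩ := exists_isAffineOpen_mem (π x)
  obtain ⟨e, ν, -, u, -, hloc⟩ :=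
    exists_local_structure hcover hX hY htorsor hy f (1 : G →* Rˣ) hn hϖ hU hyU
  rw [(hloc x' hx').1, (hloc x rfl).1]

lemma cotangentExponent_eq_of_apply_eq {x' : X} (hx' : π x' = π x) :
    cotangentExponent ρ f φ x' = cotangentExponent ρ f φ x := by
  have := hY.2 (π x)
  have := isDomain_of_regular hy
  have := isDiscreteValuationRing_of_regular hy
  obtain ⟨ϖ, hϖ⟩ := exists_hasOrder_one (O := Y.presheaf.stalk (π x))
  obtain ⟨U, hU, hyU⟩ := exists_isAffineOpen_mem (π x)
  obtain ⟨e, ν, -, u, -, hloc⟩ := exists_local_structure hcover hX hY htorsor hy f φ hn hϖ hU hyU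
  rw [(hloc x' hx').2.1, (hloc x rfl).2.1]

lemma resolventValuation_structureDivisor :
    resolventValuation ρ f (structureDivisor X) φ (π x) =
      (cotangentExponent ρ f φ x : ℚ) / ramIndex ρ x := by
  have hlt := (cotangentExponent_spec hcover hX hY htorsor hy
    (isUnit_natCast_stalk (π ≫ f) hn x) f φ).1
  rw [resolventValuation_eq hcover hX hY htorsor hy f φ hn (D := structureDivisor X) (d := 0) fun _ _ => rfl, add_zero,
    Nat.div_eq_of_lt hlt, Nat.cast_zero, sub_zero]

/-- Since `ν < e = 2 d + 1`, the quotient `⌊(ν + d) / e⌋` is `0` or `1`, and it is `0` exactly when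
`ν ≤ d`. -/
lemma resolventValuation_halfDifferent {d : ℕ} (hd : ramIndex ρ x = 2 * d + 1) :
    resolventValuation ρ f (halfDifferent ρ) φ (π x) =
      (cotangentExponent ρ f φ x : ℚ) / ramIndex ρ x -
        if cotangentExponent ρ f φ x ≤ d then 0 else 1 := by
  have hlt := (cotangentExponent_spec hcover hX hY htorsor hy
    (isUnit_natCast_stalk (π ≫ f) hn x) f φ).1
  rw [resolventValuation_eq hcover hX hY htorsor hy f φ hn (d := d) fun x' hx' => by
    rw [halfDifferent, ramIndex_eq_of_apply_eq hcover hX hY htorsor hy f hn hx', hd]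
    push_cast
    omega]
  congr 1
  split_ifs with h
  · rw [Nat.div_eq_of_lt (by omega), Nat.cast_zero]
  · rw [Nat.div_eq_of_lt_le (k := 1) (by omega) (by omega), Nat.cast_one]

/-- The sum is a multiple of `e_x`, because `φ φ⁻¹ = 1`, and it is less than `2 e_x`. -/
lemma cotangentExponent_add_inv :
    cotangentExponent ρ f φ x + cotangentExponent ρ f φ⁻¹ x =
      if 0 < cotangentExponent ρ f φ x then ramIndex ρ x else 0 := by
  have hnx := isUnit_natCast_stalk (π ≫ f) hn x
  have h1 := (cotangentExponent_spec hcover hX hY htorsor hy hnx f φ).1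
  have h2 := (cotangentExponent_spec hcover hX hY htorsor hy hnx f φ⁻¹).1
  have h3 := cotangentExponent_mul hcover hX hY htorsor hy hnx f φ φ⁻¹
  rw [(by ext g; simp : φ * φ⁻¹ = 1)] at h3
  obtain ⟨c, hc⟩ := (Nat.modEq_zero_iff_dvd).mp
    (h3.symm.trans (cotangentExponent_one hcover hX hY htorsor hy hnx f))
  have hc2 : c < 2 := by
    by_contra hc2
    have := Nat.mul_le_mul_left (ramIndex ρ x) (not_lt.mp hc2)
    omega
  rw [hc]
  interval_cases c <;> split_ifs <;> omega

lemma cotangentExponent_sq : cotangentExponent ρ f (φ ^ 2) x =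
    if 2 * cotangentExponent ρ f φ x < ramIndex ρ x then 2 * cotangentExponent ρ f φ x
      else 2 * cotangentExponent ρ f φ x - ramIndex ρ x := by
  have hnx := isUnit_natCast_stalk (π ≫ f) hn x
  have h1 := (cotangentExponent_spec hcover hX hY htorsor hy hnx f φ).1
  have h2 := (cotangentExponent_spec hcover hX hY htorsor hy hnx f (φ ^ 2)).1
  have h3 := cotangentExponent_mul hcover hX hY htorsor hy hnx f φ φ
  rw [(by ext g; simp [pow_two] : φ * φ = φ ^ 2), ← two_mul] at h3
  split_ifs with h
  · exact h3.eq_of_lt_of_lt h2 h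
  · refine Nat.ModEq.eq_of_lt_of_lt (h3.trans ?_) h2 (by omega)
    exact (Nat.modEq_iff_dvd' (by omega)).mpr ⟨1, by omega⟩ |>.symm

end Main

end ResolventDivisor

end

theorem corollary3p8 {R : Type u} [CommRing R] [IsDomain R] [IsDiscreteValuationRing R]
    [IsAdicComplete (maximalIdeal R) R]
    {G : Type v} [Group G] [Finite G]
    (hroots : ∃ ζ : R, IsPrimitiveRoot ζ (Monoid.exponent G))
    (hchar : ((Monoid.exponent G : ℕ) : ResidueField R) ≠ 0)
    {X Y : Scheme.{u}} (f : Y ⟶ Spec (CommRingCat.of R)) (hflat : Flat f) (hproper : IsProper f)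
    (hX : ResolventDivisor.IsRegularScheme X) (hY : ResolventDivisor.IsRegularScheme Y)
    (π : X ⟶ Y) (ρ : G →* Aut (Over.mk π))
    (hcover : ResolventDivisor.IsGCover ρ) (htorsor : ResolventDivisor.IsGenericallyTorsor ρ)
    (φ : G →* Rˣ) :
    (ResolventDivisor.resolventDivisor ρ f (ResolventDivisor.structureDivisor X) φ +
        ResolventDivisor.resolventDivisor ρ f (ResolventDivisor.structureDivisor X) φ⁻¹ =
      ResolventDivisor.ramificationDivisor ρ f φ) ∧
    ((∀ x : ResolventDivisor.CodimOne X, Odd (ResolventDivisor.ramIndex ρ x.1)) →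
      (ResolventDivisor.resolventDivisor ρ f (ResolventDivisor.halfDifferent ρ) φ +
          ResolventDivisor.resolventDivisor ρ f (ResolventDivisor.halfDifferent ρ) φ⁻¹ = 0) ∧
      (ResolventDivisor.resolventDivisor ρ f (ResolventDivisor.halfDifferent ρ) φ =
        ResolventDivisor.resolventDivisor ρ f (ResolventDivisor.structureDivisor X) (φ ^ 2) -
          ResolventDivisor.resolventDivisor ρ f (ResolventDivisor.structureDivisor X) φ)) := by
  open ResolventDivisor in
  have hn : IsUnit ((Monoid.exponent G : ℕ) : R) := by
    rwa [← residue_ne_zero_iff_isUnit, map_natCast]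
  have he (x : X) : (ramIndex ρ x : ℚ) ≠ 0 := by exact_mod_cast ramIndex_pos.ne'
  refine ⟨?_, fun hodd => ⟨?_, ?_⟩⟩
  · funext ⟨⟨y, hy⟩, hyf⟩
    obtain ⟨x, rfl⟩ := hcover.exists_apply_eq y
    rw [ramificationDivisor]
    change resolventValuation ρ f _ φ (π x) + resolventValuation ρ f _ φ⁻¹ (π x) = _
    rw [resolventValuation_structureDivisor hcover hX hY htorsor hy f φ hn,
      resolventValuation_structureDivisor hcover hX hY htorsor hy f φ⁻¹ hn, ← add_div,
      ← Nat.cast_add, cotangentExponent_add_inv hcover hX hY htorsor hy f φ hn]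
    have hiff : (∃ x' : CodimOne X, π x'.1 = π x ∧ 0 < cotangentExponent ρ f φ x'.1) ↔
        0 < cotangentExponent ρ f φ x := by
      refine ⟨?_, fun h => ⟨⟨x, hcover.ringKrullDim_stalk_eq_one hy⟩, rfl, h⟩⟩
      rintro ⟨x', hx', h⟩
      rwa [cotangentExponent_eq_of_apply_eq hcover hX hY htorsor hy f φ hn hx'] at h
    by_cases h : 0 < cotangentExponent ρ f φ x
    · rw [if_pos h, if_pos (hiff.mpr h), div_self (he x)]
    · rw [if_neg h, if_neg (hiff.not.mpr h), Nat.cast_zero, zero_div]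
  · funext ⟨⟨y, hy⟩, hyf⟩
    obtain ⟨x, rfl⟩ := hcover.exists_apply_eq y
    obtain ⟨d, hd⟩ := hodd ⟨x, hcover.ringKrullDim_stalk_eq_one hy⟩
    have hnx := isUnit_natCast_stalk (π ≫ f) hn x
    have h1 := (cotangentExponent_spec hcover hX hY htorsor hy hnx f φ).1
    have h2 := (cotangentExponent_spec hcover hX hY htorsor hy hnx f φ⁻¹).1
    have hadd := cotangentExponent_add_inv hcover hX hY htorsor hy f φ hn
    change resolventValuation ρ f _ φ (π x) + resolventValuation ρ f _ φ⁻¹ (π x) = 0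
    rw [resolventValuation_halfDifferent hcover hX hY htorsor hy f φ hn hd,
      resolventValuation_halfDifferent hcover hX hY htorsor hy f φ⁻¹ hn hd]
    have hd' : ramIndex ρ x = 2 * d + 1 := hd
    have hex := he x
    have haddQ : (cotangentExponent ρ f φ x : ℚ) / ramIndex ρ x +
        cotangentExponent ρ f φ⁻¹ x / ramIndex ρ x =
          if 0 < cotangentExponent ρ f φ x then 1 else 0 := by
      rw [← add_div, ← Nat.cast_add, hadd]
      split_ifs
      · exact div_self hex
      · rw [Nat.cast_zero, zero_div]
    -- For `ν > 0` exactly one of `ν` and `e - ν` exceeds `d`, and for `ν = 0` neither exponent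
    -- does; `omega` discards the other cases.
    split_ifs at hadd haddQ ⊢ <;> first | omega | linarith
  · funext ⟨⟨y, hy⟩, hyf⟩
    obtain ⟨x, rfl⟩ := hcover.exists_apply_eq y
    obtain ⟨d, hd⟩ := hodd ⟨x, hcover.ringKrullDim_stalk_eq_one hy⟩
    have hnx := isUnit_natCast_stalk (π ≫ f) hn x
    have h1 := (cotangentExponent_spec hcover hX hY htorsor hy hnx f φ).1
    change resolventValuation ρ f _ φ (π x) =
      resolventValuation ρ f _ (φ ^ 2) (π x) - resolventValuation ρ f _ φ (π x)
    rw [resolventValuation_halfDifferent hcover hX hY htorsor hy f φ hn hd,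
      resolventValuation_structureDivisor hcover hX hY htorsor hy f φ hn,
      resolventValuation_structureDivisor hcover hX hY htorsor hy f (φ ^ 2) hn,
      cotangentExponent_sq hcover hX hY htorsor hy f φ hn]
    have hd' : ramIndex ρ x = 2 * d + 1 := hd
    have hex := he x
    -- As `e = 2 d + 1`, the condition `ν ≤ d` is the same as `2 ν < e`, so both case distinctions
    -- agree.
    by_cases h : cotangentExponent ρ f φ x ≤ d
    · rw [if_pos h, if_pos (by omega)]
      push_cast
      ring
    · rw [if_neg h, if_neg (by omega), Nat.cast_sub (by omega)]
      push_cast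
      field_simp
      ring
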